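/- For positive integers $n,k,m$ with $k\le n-1$ and $k\le m\le N:=\binom n2$, let $\mathbb P_0$ be the Erdős–Rényi model $G(n,m)$, i.e. the uniform distribution on all graphs with vertex set $[n]$ and exactly $m$ edges, and let $\mathbb P_1$ be the planted star model: choose a hub $v_*\in[n]$ uniformly at random, then a uniformly random set $S$ of $k$ of the $n-1$ possible edges incident to $v_*$, then a uniformly random set $R$ of $m-k$ of the remaining $N-k$ possible edges, and output the graph with edge set $S\cup R$. Suppose $k=k(n)$ satisfies $(\log n)^2\ll k\ll\sqrt n$ (that is, $(\log n)^2=o(k)$ and $k=o(\sqrt n)$ as $n\to\infty$). Fix $\gamma\in\mathbb R$, and let $m=m(n)$ be an integer such that, for all large $n$, \[ \left|\,m-\frac{k^2n}{4\log n}\left(1+\frac{\gamma}{\sqrt{\log n}}\right)\right|<1, \] i.e. $m$ equals $\frac{k^2n}{4\log n}\bigl(1+\frac{\gamma}{\sqrt{\log n}}\bigr)$ up to rounding to an adjacent integer. Then, as $n\to\infty$, \[ \mathsf{TV}(\mathbb P_1,\mathbb P_0)=1-\Phi\!\left(\frac{\gamma}{\sqrt2}\right)+o(1), \] where $\mathsf{TV}(P,Q)=\sup_A|P(A)-Q(A)|$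 is the total variation distance and $\Phi$ is the standard Gaussian distribution function. (For large $n$ the constraints on $n,k,m$ above hold automatically.) -/

import Mathlib

open Filter Topology Asymptotics ProbabilityTheory

noncomputable section

namespace PlantedStar

/-- Sample `a` uniformly at random from the finite set `s`, then sample from `f a`.
If `s` is empty, so that no choice is possible, the result is the constant `default`. -/
def chooseThen {α β : Type} [Inhabited β] (s : Finset α) (f : α → PMF β) : PMF β :=
  open Classical in
  if hs : s.Nonempty then (PMF.uniformOfFinset s hs).bind f else PMF.pure default

/-- All `n.choose 2` possible edges on the vertex set `Fin n`. -/
def allEdges (n : ℕ) : Finset (Sym2 (Fin n)) :=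
  (⊤ : SimpleGraph (Fin n)).edgeFinset

/-- The `n - 1` possible edges on the vertex set `Fin n` that are incident to `v`. -/
def edgesAt (n : ℕ) (v : Fin n) : Finset (Sym2 (Fin n)) :=
  (⊤ : SimpleGraph (Fin n)).incidenceFinset v

/-- The Erdős–Rényi model `G(n, m)`: a uniformly random graph among all graphs on `Fin n`
with exactly `m` edges. -/
def nullModel (n m : ℕ) : PMF (SimpleGraph (Fin n)) :=
  open Classical in
  chooseThen (Finset.univ.filter fun G : SimpleGraph (Fin n) => G.edgeFinset.card = m) PMF.pure

/-- The planted star model: pick a uniformly random hub `v`, then a uniformly random set `S` of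
`k` edges incident to `v`, then a uniformly random set `R` of `m - k` edges among all possible
edges outside `S`; the sample is the graph with edge set `S ∪ R`. It is meant for
`k ≤ n - 1` and `k ≤ m ≤ n.choose 2`. -/
def plantedModel (n k m : ℕ) : PMF (SimpleGraph (Fin n)) :=
  chooseThen Finset.univ fun v =>
    chooseThen ((edgesAt n v).powersetCard k) fun S =>
      chooseThen ((allEdges n \ S).powersetCard (m - k)) fun R =>
        PMF.pure (SimpleGraph.fromEdgeSet ((S ∪ R : Finset (Sym2 (Fin n))) : Set (Sym2 (Fin n))))

/-- Total variation distance of two discrete probability distributions: the supremum over all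
events `A` of the difference of the probabilities of `A`. -/
def tvDist {Ω : Type} (P Q : PMF Ω) : ℝ :=
  ⨆ A : Set Ω, |(P.toOuterMeasure A).toReal - (Q.toOuterMeasure A).toReal|

/-- The distribution function `Φ` of the standard Gaussian. -/
def stdGaussianCDF (x : ℝ) : ℝ :=
  cdf (gaussianReal 0 1) x

end PlantedStar

end

/-!
The likelihood ratio of the planted star model with respect to `G(n, m)` is the average over all
vertices `v` of `ℓ (deg v)`, where `ℓ j` (`starRatio`) is `j.choose k` divided by its expectation.
With `d = 2 m / n` the average degree, planting a star moves the hub degree by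
`k = √d (√(2 log n) - γ / √2 + o(1))`, while the largest degree of `G(n, m)` exceeds `d` by
`√d (√(2 log n) + o(1))`: the random energy model at its critical temperature. So the likelihood
ratio converges under `G(n, m)` to the probability `Φ(γ / √2)` that the hub stays below the largest
degree, and the total variation distance, the expectation of its deficit from `1`, converges to
`1 - Φ(γ / √2)`.

Both bounds compare degrees with a threshold `T` which lies `√(2 log n) + s` standard deviations
above `d` for a fixed `s ≠ 0`, and `s → 0` at the end. Since `log (ℓ T / n) = (s + o(1)) √(2 log n)`
(this is where `(log n) ^ 2 = o(k)` is needed), every estimate has room to spare.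

* Lower bound (`one_sub_hubCDF_sub_le_tvDist`, `s > 0`): test whether some degree exceeds `T`. As
  the degree law of a planted hub has density `ℓ` with respect to the null degree law and `ℓ` is
  increasing, the null probability of this event is at most `n / ℓ T`.
* Upper bound (`tvDist_le_one_sub_hubCDF_add`, `s < 0`): replace `ℓ` by `min ℓ (ℓ T)`. The average
  of these truncated ratios concentrates by a second moment computation. The diagonal costs
  `ℓ T / n`; off the diagonal, the two degrees are negatively correlated once it is known whether
  the edge between the two vertices is present (`sum_powersetCard_mul_le`), and that edge carries
  little weight.
* The hub degree is `k` plus a hypergeometric variable. Its central limit theorem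
  (`tendsto_hyperMean_le`) follows from the Stein identity `hyperMean_stein`, by which the
  characteristic function almost solves `φ' = -t φ`, and Lévy's continuity theorem.
-/

namespace PlantedStar
open Finset

/-! ### The hypergeometric law and the likelihood ratio of one hub -/

/-- Expectation of `f(Y)` for the hypergeometric variable `Y`, the number of marked elements in a
uniformly random `m`-subset of a set with `K` marked and `B` unmarked elements. Summing over the
pairs `(i, j)` with `i + j = m` avoids truncated subtraction. -/
noncomputable def hyperMean {𝕜 : Type*} [Field 𝕜] (K B m : ℕ) (f : ℕ → 𝕜) : 𝕜 :=
  (∑ p ∈ antidiagonal m, (K.choose p.1 : 𝕜) * B.choose p.2 * f p.1) / (K + B).choose m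

section Algebra
variable {𝕜 : Type*} [Field 𝕜]

theorem choose_add_ne_zero [CharZero 𝕜] {K B m : ℕ} (h : m ≤ K + B) :
    ((K + B).choose m : 𝕜) ≠ 0 := by
  exact_mod_cast (Nat.choose_pos h).ne'

theorem hyperMean_congr {K B m : ℕ} {f g : ℕ → 𝕜} (h : ∀ i ≤ m, i ≤ K → f i = g i) :
    hyperMean K B m f = hyperMean K B m g := by
  unfold hyperMean
  congr 1
  refine Finset.sum_congr rfl fun p hp => ?_
  by_cases hK : p.1 ≤ K
  · rw [h p.1 (by have := mem_antidiagonal.1 hp; omega) hK]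
  · rw [Nat.choose_eq_zero_of_lt (not_le.1 hK)]; simp

theorem hyperMean_one [CharZero 𝕜] {K B m : ℕ} (h : m ≤ K + B) :
    hyperMean K B m (fun _ => (1 : 𝕜)) = 1 := by
  have h0 : ((K + B).choose m : 𝕜) ≠ 0 := choose_add_ne_zero h
  rw [hyperMean, div_eq_one_iff_eq h0, Nat.add_choose_eq]
  push_cast
  simp

theorem hyperMean_add (K B m : ℕ) (f g : ℕ → 𝕜) :
    hyperMean K B m (fun i => f i + g i) = hyperMean K B m f + hyperMean K B m g := by
  simp only [hyperMean, mul_add, sum_add_distrib, add_div]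

theorem hyperMean_sub (K B m : ℕ) (f g : ℕ → 𝕜) :
    hyperMean K B m (fun i => f i - g i) = hyperMean K B m f - hyperMean K B m g := by
  simp only [hyperMean, mul_sub, sum_sub_distrib, sub_div]

theorem hyperMean_const_mul (K B m : ℕ) (c : 𝕜) (f : ℕ → 𝕜) :
    hyperMean K B m (fun i => c * f i) = c * hyperMean K B m f := by
  simp only [hyperMean, mul_left_comm _ c, ← mul_sum, mul_div_assoc]

theorem choose_mul_sub_cast (n i : ℕ) :
    ((n.choose i : ℕ) : 𝕜) * ((n : 𝕜) - i) = n.choose (i + 1) * ((i : 𝕜) + 1) := by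
  rcases le_or_gt i n with h | h
  · have := Nat.choose_succ_right_eq n i
    rw [← Nat.cast_sub h, ← Nat.cast_mul, ← this]
    push_cast
    rfl
  · rw [Nat.choose_eq_zero_of_lt h, Nat.choose_eq_zero_of_lt (by omega)]; simp

/-- Stein identity of the hypergeometric law, a consequence of detailed balance between
neighbouring values. -/
theorem hyperMean_stein (K B m : ℕ) (g : ℕ → 𝕜) :
    hyperMean K B m (fun i => (((K + B : ℕ) : 𝕜) * i - K * m) * g i) =
      hyperMean K B m (fun i => ((K : 𝕜) - i) * ((m : 𝕜) - i) * (g (i + 1) - g i)) := by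
  have key : ∑ p ∈ antidiagonal m, (K.choose p.1 : 𝕜) * B.choose p.2 *
        ((p.1 : 𝕜) * ((B : 𝕜) - p.2) * g p.1) =
      ∑ p ∈ antidiagonal m, (K.choose p.1 : 𝕜) * B.choose p.2 *
        (((K : 𝕜) - p.1) * p.2 * g (p.1 + 1)) := by
    cases m with
    | zero => simp
    | succ m =>
      rw [Finset.Nat.sum_antidiagonal_succ, Finset.Nat.sum_antidiagonal_succ']
      simp only [Nat.cast_zero, zero_mul, mul_zero, zero_add]
      refine Finset.sum_congr rfl fun p _ => ?_
      have h1 := choose_mul_sub_cast (𝕜 := 𝕜) K p.1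
      have h2 := choose_mul_sub_cast (𝕜 := 𝕜) B p.2
      push_cast
      linear_combination (K.choose p.1 : 𝕜) * ((K : 𝕜) - p.1) * g (p.1 + 1) * h2
        - (B.choose p.2 : 𝕜) * ((B : 𝕜) - p.2) * g (p.1 + 1) * h1
  unfold hyperMean
  congr 1
  have e1 : ∀ p ∈ antidiagonal m, (K.choose p.1 : 𝕜) * B.choose p.2 *
      ((((K + B : ℕ) : 𝕜) * p.1 - K * m) * g p.1) =
      (K.choose p.1 : 𝕜) * B.choose p.2 * ((p.1 : 𝕜) * ((B : 𝕜) - p.2) * g p.1) -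
      (K.choose p.1 : 𝕜) * B.choose p.2 * (((K : 𝕜) - p.1) * p.2 * g p.1) := by
    intro p hp
    rw [← mem_antidiagonal.1 hp]
    push_cast
    ring
  have e2 : ∀ p ∈ antidiagonal m, (K.choose p.1 : 𝕜) * B.choose p.2 *
      (((K : 𝕜) - p.1) * ((m : 𝕜) - p.1) * (g (p.1 + 1) - g p.1)) =
      (K.choose p.1 : 𝕜) * B.choose p.2 * (((K : 𝕜) - p.1) * p.2 * g (p.1 + 1)) -
      (K.choose p.1 : 𝕜) * B.choose p.2 * (((K : 𝕜) - p.1) * p.2 * g p.1) := by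
    intro p hp
    rw [← mem_antidiagonal.1 hp]
    push_cast
    ring
  rw [Finset.sum_congr rfl e1, Finset.sum_congr rfl e2, sum_sub_distrib, sum_sub_distrib, key]

theorem hyperMean_id [CharZero 𝕜] {K B m : ℕ} (h : m ≤ K + B) (h0 : 0 < K + B) :
    hyperMean K B m (fun i => (i : 𝕜)) = K * m / ((K + B : ℕ) : 𝕜) := by
  have h1 := hyperMean_stein (𝕜 := 𝕜) K B m (fun _ => 1)
  simp only [mul_one, sub_self, mul_zero] at h1
  rw [hyperMean_sub, hyperMean_const_mul] at h1
  have h2 : hyperMean K B m (fun _ => ((K : 𝕜) * m)) = K * m := by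
    have := hyperMean_const_mul K B m ((K : 𝕜) * m) (fun _ => 1)
    rw [hyperMean_one h] at this
    simpa using this
  have h3 : hyperMean K B m (fun _ => (0 : 𝕜)) = 0 := by simp [hyperMean]
  rw [h2, h3] at h1
  have h4 : ((K + B : ℕ) : 𝕜) ≠ 0 := by exact_mod_cast h0.ne'
  rw [eq_div_iff h4]
  linear_combination h1

theorem sum_antidiagonal_add_of_eq_zero {M : Type*} [AddCommMonoid M] (k m : ℕ)
    (F : ℕ × ℕ → M) (hF : ∀ p, p.1 < k → F p = 0) :
    ∑ p ∈ antidiagonal (m + k), F p = ∑ p ∈ antidiagonal m, F (p.1 + k, p.2) := by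
  induction k generalizing F with
  | zero => simp
  | succ k ih =>
    rw [← add_assoc, Finset.Nat.sum_antidiagonal_succ, hF _ (Nat.succ_pos k), zero_add,
      ih (fun p => F (p.1 + 1, p.2)) (fun p hp => hF _ (by simpa using hp))]
    simp only [add_assoc]

/-- The normalisation of the likelihood ratio: the expected number of `k`-subsets of marked
elements in the sample. -/
noncomputable def starWeight (K B m k : ℕ) : ℝ :=
  K.choose k * (K + B - k).choose (m - k) / (K + B).choose m

/-- The likelihood ratio of the planted to the null model for one fixed hub, as a function of the
degree `j` of that hub. -/
noncomputable def starRatio (K B m k j : ℕ) : ℝ := j.choose k / starWeight K B m k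

theorem starWeight_pos {K B m k : ℕ} (hK : k ≤ K) (hm : k ≤ m) (h : m ≤ K + B) :
    0 < starWeight K B m k := by
  unfold starWeight
  have h1 := Nat.choose_pos hK
  have h2 := Nat.choose_pos h
  have h3 : 0 < (K + B - k).choose (m - k) := Nat.choose_pos (by omega)
  positivity

theorem starRatio_nonneg {K B m k : ℕ} (j : ℕ) : 0 ≤ starRatio K B m k j := by
  unfold starRatio starWeight; positivity

theorem starRatio_mono (K B m k : ℕ) : Monotone (starRatio K B m k) := by
  intro i j hij
  unfold starRatio
  have : i.choose k ≤ j.choose k := Nat.choose_le_choose k hij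
  have h0 : 0 ≤ starWeight K B m k := by unfold starWeight; positivity
  gcongr

/-- Weighting the null degree law by the likelihood ratio gives the hub degree law of the planted
model. -/
theorem hyperMean_starRatio_mul {K B m k : ℕ} (hK : k ≤ K) (hm : k ≤ m) (h : m ≤ K + B)
    (f : ℕ → ℝ) :
    hyperMean K B m (fun i => starRatio K B m k i * f i) =
      hyperMean (K - k) B (m - k) (fun i => f (i + k)) := by
  obtain ⟨m, rfl⟩ := Nat.exists_eq_add_of_le' hm
  have h0 : ((K + B).choose (m + k) : ℝ) ≠ 0 := choose_add_ne_zero h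
  have hw := (starWeight_pos hK hm h).ne'
  have h1 : ((K - k + B).choose m : ℝ) ≠ 0 := choose_add_ne_zero (by omega)
  have h2 : (K.choose k : ℝ) ≠ 0 := by exact_mod_cast (Nat.choose_pos hK).ne'
  unfold hyperMean
  rw [sum_antidiagonal_add_of_eq_zero k m]
  · simp only [starRatio, starWeight, Nat.add_sub_cancel]
    rw [show K + B - k = K - k + B by omega, div_eq_div_iff h0 h1, sum_mul, sum_mul]
    refine Finset.sum_congr rfl fun p _ => ?_
    have h3 : (K.choose (p.1 + k) : ℝ) * (p.1 + k).choose k = K.choose k * (K - k).choose p.1 := by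
      rcases le_or_gt (p.1 + k) K with hp | hp
      · have := Nat.choose_mul (n := K) (Nat.le_add_left k p.1)
        rw [Nat.add_sub_cancel] at this
        exact_mod_cast this
      · rw [Nat.choose_eq_zero_of_lt hp, Nat.choose_eq_zero_of_lt (show K - k < p.1 by omega)]
        simp
    field_simp
    linear_combination (B.choose p.2 : ℝ) * f (p.1 + k) * h3
  · intro p hp
    simp [starRatio, Nat.choose_eq_zero_of_lt hp]

/-- The variable `Y` reweighted by its value (size bias): one marked element is forced into the
sample. -/
theorem hyperMean_succ [CharZero 𝕜] {K B m : ℕ} (f : ℕ → 𝕜) (h : m + 1 ≤ K + 1 + B) :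
    hyperMean (K + 1) B (m + 1) (fun i => (i : 𝕜) * f i) / (K + 1 : ℕ) =
      hyperMean K B m (fun i => f (i + 1)) * (K + B).choose m / (K + 1 + B).choose (m + 1) := by
  have h1 : ((K + B).choose m : 𝕜) ≠ 0 := choose_add_ne_zero (by omega)
  have h2 : ((K + 1 + B).choose (m + 1) : 𝕜) ≠ 0 := choose_add_ne_zero h
  have h3 : ((K + 1 : ℕ) : 𝕜) ≠ 0 := by exact_mod_cast Nat.succ_ne_zero K
  unfold hyperMean
  rw [Finset.Nat.sum_antidiagonal_succ]
  simp only [Nat.cast_zero, zero_mul, mul_zero, zero_add]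
  rw [div_mul_cancel₀ _ h1, div_right_comm]
  congr 1
  rw [div_eq_iff h3, sum_mul]
  refine Finset.sum_congr rfl fun p _ => ?_
  have : ((K + 1).choose (p.1 + 1) : 𝕜) * ((p.1 + 1 : ℕ) : 𝕜) = (K + 1 : ℕ) * K.choose p.1 := by
    exact_mod_cast (Nat.add_one_mul_choose_eq K p.1).symm
  linear_combination (B.choose p.2 : 𝕜) * f (p.1 + 1) * this

end Algebra

theorem hyperMean_mono {K B m : ℕ} {f g : ℕ → ℝ} (h : ∀ i ≤ m, i ≤ K → f i ≤ g i) :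
    hyperMean K B m f ≤ hyperMean K B m g := by
  unfold hyperMean
  refine div_le_div_of_nonneg_right (sum_le_sum fun p hp => ?_) (by positivity)
  by_cases hK : p.1 ≤ K
  · have := h p.1 (by have := mem_antidiagonal.1 hp; omega) hK
    gcongr
  · rw [Nat.choose_eq_zero_of_lt (not_le.1 hK)]; simp

theorem hyperMean_nonneg {K B m : ℕ} {f : ℕ → ℝ} (h : ∀ i, 0 ≤ f i) : 0 ≤ hyperMean K B m f := by
  unfold hyperMean
  exact div_nonneg (sum_nonneg fun p _ => mul_nonneg (by positivity) (h _)) (by positivity)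

/-! ### Sums over subsets of prescribed size -/

section Sets
variable {α : Type*} [DecidableEq α]

/-- An `m`-subset of a disjoint union is a pair of subsets whose sizes add up to `m`. -/
theorem sum_powersetCard_union {β : Type*} [AddCommMonoid β] {A C : Finset α}
    (h : Disjoint A C) (m : ℕ) (G : Finset α → β) :
    ∑ E ∈ powersetCard m (A ∪ C), G E =
      ∑ p ∈ antidiagonal m, ∑ X ∈ powersetCard p.1 A, ∑ Y ∈ powersetCard p.2 C, G (X ∪ Y) := by
  simp_rw [← Finset.sum_product']
  rw [Finset.sum_sigma']
  have hd : ∀ {X Y : Finset α}, X ⊆ A → Y ⊆ C → (X ∪ Y) ∩ A = X ∧ (X ∪ Y) ∩ C = Y := by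
    intro X Y hX hY
    constructor
    · rw [union_inter_distrib_right, inter_eq_left.2 hX,
        (disjoint_iff_inter_eq_empty.1 (h.symm.mono_left hY)), union_empty]
    · rw [union_inter_distrib_right, inter_eq_left.2 hY,
        (disjoint_iff_inter_eq_empty.1 (h.mono_left hX)), empty_union]
  refine Finset.sum_bij' (fun E _ => ⟨(#(E ∩ A), #(E ∩ C)), (E ∩ A, E ∩ C)⟩)
    (fun x _ => x.2.1 ∪ x.2.2) ?_ ?_ ?_ ?_ ?_
  · intro E hE
    rw [mem_powersetCard] at hE
    have : #(E ∩ A) + #(E ∩ C) = m := by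
      rw [← card_union_of_disjoint (h.mono inter_subset_right inter_subset_right),
        ← inter_union_distrib_left, inter_eq_left.2 hE.1, hE.2]
    simp [this, mem_powersetCard]
  · rintro ⟨⟨i, j⟩, ⟨X, Y⟩⟩ hx
    simp only [mem_sigma, HasAntidiagonal.mem_antidiagonal, mem_product, mem_powersetCard] at hx ⊢
    obtain ⟨h1, ⟨h2, h3⟩, h4, h5⟩ := hx
    exact ⟨union_subset_union h2 h4,
      by rw [card_union_of_disjoint (h.mono h2 h4), h3, h5, h1]⟩
  · intro E hE
    rw [mem_powersetCard] at hE
    simp only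
    rw [← inter_union_distrib_left, inter_eq_left.2 hE.1]
  · rintro ⟨⟨i, j⟩, ⟨X, Y⟩⟩ hx
    simp only [mem_sigma, HasAntidiagonal.mem_antidiagonal, mem_product, mem_powersetCard] at hx ⊢
    obtain ⟨h1, ⟨h2, h3⟩, h4, h5⟩ := hx
    rw [(hd h2 h4).1, (hd h2 h4).2, h3, h5]
  · intro E hE
    rw [mem_powersetCard] at hE
    simp only
    rw [← inter_union_distrib_left, inter_eq_left.2 hE.1]

/-- The number of marked elements in a random `m`-subset is hypergeometric. -/
theorem sum_powersetCard_card_inter {A U : Finset α} (hA : A ⊆ U) (m : ℕ) (f : ℕ → ℝ) :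
    ∑ E ∈ powersetCard m U, f #(E ∩ A) =
      (#U).choose m * hyperMean #A (#U - #A) m f := by
  have hcard := card_le_card hA
  rcases le_or_gt m #U with hm | hm
  · have h0 : ((#A + (#U - #A)).choose m : ℝ) ≠ 0 := choose_add_ne_zero (by omega)
    rw [hyperMean, show (#U).choose m = (#A + (#U - #A)).choose m by congr 1; omega,
      mul_div_cancel₀ _ h0]
    conv_lhs => rw [← union_sdiff_of_subset hA]
    rw [sum_powersetCard_union disjoint_sdiff]
    refine Finset.sum_congr rfl fun p _ => ?_
    have : ∀ X ∈ powersetCard p.1 A, ∑ Y ∈ powersetCard p.2 (U \ A), f #((X ∪ Y) ∩ A) =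
        (#U - #A).choose p.2 * f p.1 := by
      intro X hX
      rw [mem_powersetCard] at hX
      rw [← card_sdiff_of_subset hA, ← card_powersetCard, ← nsmul_eq_mul]
      refine Finset.sum_eq_card_nsmul fun Y hY => ?_
      rw [mem_powersetCard] at hY
      rw [union_inter_distrib_right, inter_eq_left.2 hX.1,
        (disjoint_iff_inter_eq_empty.1 (disjoint_sdiff.symm.mono_left hY.1)), union_empty, hX.2]
    rw [Finset.sum_congr rfl this, sum_const, card_powersetCard, nsmul_eq_mul, mul_assoc]
  · rw [powersetCard_eq_empty.2 hm, Nat.choose_eq_zero_of_lt hm]; simp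

/-- Double counting: each `m`-set contains `(#(E ∩ A)).choose k` sets `S ⊆ A` of size `k`. -/
theorem sum_powersetCard_sdiff {β : Type*} [AddCommMonoid β] {A U : Finset α} (hA : A ⊆ U)
    {k m : ℕ} (hkm : k ≤ m) (G : Finset α → β) :
    ∑ S ∈ powersetCard k A, ∑ R ∈ powersetCard (m - k) (U \ S), G (S ∪ R) =
      ∑ E ∈ powersetCard m U, (#(E ∩ A)).choose k • G E := by
  have h1 : ∀ E ∈ powersetCard m U, (#(E ∩ A)).choose k • G E =
      ∑ S ∈ powersetCard k (E ∩ A), G E := by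
    intro E _
    rw [sum_const, card_powersetCard]
  rw [Finset.sum_congr rfl h1, Finset.sum_sigma', Finset.sum_sigma']
  refine Finset.sum_bij' (fun x _ => ⟨x.1 ∪ x.2, x.1⟩) (fun x _ => ⟨x.2, x.1 \ x.2⟩)
    ?_ ?_ ?_ ?_ ?_
  · rintro ⟨S, R⟩ hx
    simp only [mem_sigma, mem_powersetCard] at hx ⊢
    obtain ⟨⟨h1, h2⟩, h3, h4⟩ := hx
    refine ⟨⟨union_subset (h1.trans hA) (h3.trans sdiff_subset), ?_⟩,
      subset_inter subset_union_left h1, h2⟩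
    rw [card_union_of_disjoint (disjoint_sdiff.mono_right h3), h2, h4]
    omega
  · rintro ⟨E, S⟩ hx
    simp only [mem_sigma, mem_powersetCard] at hx ⊢
    obtain ⟨⟨h1, h2⟩, h3, h4⟩ := hx
    refine ⟨⟨h3.trans inter_subset_right, h4⟩, sdiff_subset_sdiff h1 le_rfl, ?_⟩
    rw [card_sdiff_of_subset (h3.trans inter_subset_left), h2, h4]
  · rintro ⟨S, R⟩ hx
    simp only [mem_sigma, mem_powersetCard] at hx ⊢
    obtain ⟨⟨h1, h2⟩, h3, h4⟩ := hx
    congr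
    rw [union_sdiff_cancel_left (disjoint_sdiff.mono_right h3)]
  · rintro ⟨E, S⟩ hx
    simp only [mem_sigma, mem_powersetCard] at hx ⊢
    congr
    rw [union_sdiff_of_subset (hx.2.1.trans inter_subset_left)]
  · intros; rfl

end Sets

/-! ### Negative correlation -/

/-- The binomial coefficients `n.choose ·` form a log-concave sequence. -/
theorem choose_mul_choose_add_le (n x y p : ℕ) (hxy : x ≤ y) :
    n.choose x * n.choose (y + p) ≤ n.choose (x + p) * n.choose y := by
  induction p with
  | zero => simp
  | succ p ih =>
    rcases le_or_gt n (y + p) with hn | hn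
    · rw [Nat.choose_eq_zero_of_lt (show n < y + (p + 1) by omega)]; simp
    have h1 := Nat.choose_succ_right_eq n (y + p)
    have h2 := Nat.choose_succ_right_eq n (x + p)
    have hpos : 0 < (x + p + 1) * (y + p + 1) := by positivity
    refine Nat.le_of_mul_le_mul_right ?_ hpos
    calc n.choose x * n.choose (y + (p + 1)) * ((x + p + 1) * (y + p + 1))
        = n.choose x * (n.choose (y + p + 1) * (y + p + 1)) * (x + p + 1) := by
          rw [add_assoc y p 1]; ring
      _ = (n.choose x * n.choose (y + p)) * ((n - (y + p)) * (x + p + 1)) := by rw [h1]; ring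
      _ ≤ (n.choose (x + p) * n.choose y) * ((n - (x + p)) * (y + p + 1)) := by
          gcongr
      _ = (n.choose (x + p + 1) * (x + p + 1)) * n.choose y * (y + p + 1) := by rw [h2]; ring
      _ = n.choose (x + (p + 1)) * n.choose y * ((x + p + 1) * (y + p + 1)) := by
          rw [add_assoc x p 1]; ring

/-- Two increasing functions of the coordinates are negatively correlated under a weight that is
reverse regular of order two. -/
theorem sum_mul_sum_le_of_reverse_rule (s : Finset ℕ) (P : ℕ → ℕ → ℝ)
    (hP : ∀ i i' j j', i ≤ i' → j ≤ j' → P i j * P i' j' ≤ P i j' * P i' j)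
    {f g : ℕ → ℝ} (hf : Monotone f) (hg : Monotone g) :
    (∑ i ∈ s, ∑ j ∈ s, P i j * (f i * g j)) * (∑ i ∈ s, ∑ j ∈ s, P i j) ≤
      (∑ i ∈ s, ∑ j ∈ s, P i j * f i) * (∑ i ∈ s, ∑ j ∈ s, P i j * g j) := by
  -- Symmetrised covariance: the sum over pairs `(i, j)`, `(i', j')`.
  set Q : ℕ → ℕ → ℕ → ℕ → ℝ := fun i i' j j' => P i j * P i' j' * ((f i - f i') * (g j - g j'))
    with hQ
  have h1 : ∑ i ∈ s, ∑ i' ∈ s, ∑ j ∈ s, ∑ j' ∈ s, (Q i i' j j' + Q i i' j' j) ≤ 0 := by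
    refine sum_nonpos fun i _ => sum_nonpos fun i' _ => sum_nonpos fun j _ =>
      sum_nonpos fun j' _ => ?_
    have e : Q i i' j j' + Q i i' j' j =
        (P i j * P i' j' - P i j' * P i' j) * ((f i - f i') * (g j - g j')) := by
      simp only [hQ]; ring
    rw [e]
    rcases le_total i i' with hi | hi <;> rcases le_total j j' with hj | hj
    · exact mul_nonpos_of_nonpos_of_nonneg (by linarith [hP i i' j j' hi hj])
        (mul_nonneg_of_nonpos_of_nonpos (by linarith [hf hi]) (by linarith [hg hj]))
    · exact mul_nonpos_of_nonneg_of_nonpos (by linarith [hP i i' j' j hi hj])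
        (mul_nonpos_of_nonpos_of_nonneg (by linarith [hf hi]) (by linarith [hg hj]))
    · exact mul_nonpos_of_nonneg_of_nonpos (by linarith [hP i' i j j' hi hj])
        (mul_nonpos_of_nonneg_of_nonpos (by linarith [hf hi]) (by linarith [hg hj]))
    · exact mul_nonpos_of_nonpos_of_nonneg (by linarith [hP i' i j' j hi hj])
        (mul_nonneg (by linarith [hf hi]) (by linarith [hg hj]))
  -- Exchanging `j` and `j'` identifies the two halves of the symmetrised sum, and each half is
  -- twice the covariance.
  have h2 : ∑ i ∈ s, ∑ i' ∈ s, ∑ j ∈ s, ∑ j' ∈ s, Q i i' j' j =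
      ∑ i ∈ s, ∑ i' ∈ s, ∑ j ∈ s, ∑ j' ∈ s, Q i i' j j' :=
    sum_congr rfl fun i _ => sum_congr rfl fun i' _ => sum_comm
  have hprod : ∀ u v : ℕ → ℕ → ℝ,
      ∑ i ∈ s, ∑ i' ∈ s, ∑ j ∈ s, ∑ j' ∈ s, u i j * v i' j' =
        (∑ i ∈ s, ∑ j ∈ s, u i j) * (∑ i ∈ s, ∑ j ∈ s, v i j) := by
    intro u v
    simp only [sum_mul_sum]
  have h3 : ∑ i ∈ s, ∑ i' ∈ s, ∑ j ∈ s, ∑ j' ∈ s, Q i i' j j' =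
      2 * ((∑ i ∈ s, ∑ j ∈ s, P i j * (f i * g j)) * (∑ i ∈ s, ∑ j ∈ s, P i j) -
      (∑ i ∈ s, ∑ j ∈ s, P i j * f i) * (∑ i ∈ s, ∑ j ∈ s, P i j * g j)) := by
    have e : ∀ i i' j j', Q i i' j j' = (P i j * (f i * g j)) * P i' j' -
        (P i j * f i) * (P i' j' * g j') - (P i j * g j) * (P i' j' * f i') +
        P i j * (P i' j' * (f i' * g j')) := by
      intros; simp only [hQ]; ring
    simp only [e, sum_add_distrib, sum_sub_distrib]
    rw [hprod (fun i j => P i j * (f i * g j)) P,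
      hprod (fun i j => P i j * f i) (fun i j => P i j * g j),
      hprod (fun i j => P i j * g j) (fun i j => P i j * f i),
      hprod P (fun i j => P i j * (f i * g j))]
    ring
  simp only [sum_add_distrib] at h1
  rw [h2, h3] at h1
  linarith

section Sets
variable {α : Type*} [DecidableEq α]

/-- Joint law of the numbers of sampled elements in two disjoint sets. -/
theorem sum_powersetCard_card_inter_pair {A B U : Finset α} (hA : A ⊆ U) (hB : B ⊆ U)
    (hAB : Disjoint A B) (m : ℕ) (F : ℕ → ℕ → ℝ) :
    ∑ E ∈ powersetCard m U, F #(E ∩ A) #(E ∩ B) =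
      ∑ i ∈ range (m + 1), ∑ j ∈ range (m + 1), ((#A).choose i * (#B).choose j *
        (if i + j ≤ m then ((#(U \ (A ∪ B))).choose (m - (i + j)) : ℝ) else 0)) * F i j := by
  set C := U \ (A ∪ B) with hC
  have hBC : Disjoint B C :=
    (disjoint_sdiff (s := A ∪ B) (t := U)).mono_left subset_union_right
  have hAC : Disjoint A C :=
    (disjoint_sdiff (s := A ∪ B) (t := U)).mono_left subset_union_left
  have hU : U = A ∪ (B ∪ C) := by
    rw [← union_assoc, hC, union_sdiff_of_subset (union_subset hA hB)]
  conv_lhs => rw [hU]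
  rw [sum_powersetCard_union (disjoint_union_right.2 ⟨hAB, hAC⟩),
    Finset.Nat.sum_antidiagonal_eq_sum_range_succ_mk]
  refine sum_congr rfl fun i hi => ?_
  have hi' : i ≤ m := Nat.lt_succ_iff.1 (mem_range.1 hi)
  have h1 : ∀ X ∈ powersetCard i A, ∑ Y ∈ powersetCard (m - i) (B ∪ C),
      F #((X ∪ Y) ∩ A) #((X ∪ Y) ∩ B) =
      ∑ p ∈ antidiagonal (m - i), ((#B).choose p.1 : ℝ) * ((#C).choose p.2 * F i p.1) := by
    intro X hX
    rw [mem_powersetCard] at hX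
    rw [sum_powersetCard_union hBC]
    refine sum_congr rfl fun p _ => ?_
    rw [← card_powersetCard p.1 B, ← nsmul_eq_mul]
    refine sum_eq_card_nsmul fun Y hY => ?_
    rw [← card_powersetCard p.2 C, ← nsmul_eq_mul]
    refine sum_eq_card_nsmul fun Z hZ => ?_
    rw [mem_powersetCard] at hY hZ
    have e1 : (X ∪ (Y ∪ Z)) ∩ A = X := by
      rw [union_inter_distrib_right, union_inter_distrib_right, inter_eq_left.2 hX.1,
        disjoint_iff_inter_eq_empty.1 (hAB.symm.mono_left hY.1),
        disjoint_iff_inter_eq_empty.1 (hAC.symm.mono_left hZ.1)]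
      simp
    have e2 : (X ∪ (Y ∪ Z)) ∩ B = Y := by
      rw [union_inter_distrib_right, union_inter_distrib_right, inter_eq_left.2 hY.1,
        disjoint_iff_inter_eq_empty.1 (hAB.mono_left hX.1),
        disjoint_iff_inter_eq_empty.1 (hBC.symm.mono_left hZ.1)]
      simp
    rw [e1, e2, hX.2, hY.2]
  rw [sum_congr rfl h1, sum_const, card_powersetCard,
    Finset.Nat.sum_antidiagonal_eq_sum_range_succ_mk, nsmul_eq_mul, mul_sum]
  have h2 : range ((m - i).succ) ⊆ range (m + 1) := range_subset_range.2 (by omega)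
  refine sum_subset_zero_on_sdiff h2 (fun j hj => ?_) (fun j hj => ?_)
  · rw [Finset.mem_sdiff, mem_range, mem_range] at hj
    rw [if_neg (by omega), mul_zero, zero_mul]
  · rw [mem_range] at hj
    rw [if_pos (by omega), Nat.sub_sub]
    ring

/-- The numbers of sampled elements in two disjoint sets are negatively correlated, in the strong
sense that this holds for all increasing functions of them. -/
theorem sum_powersetCard_mul_le {A B U : Finset α} (hA : A ⊆ U) (hB : B ⊆ U)
    (hAB : Disjoint A B) (m : ℕ) {f g : ℕ → ℝ} (hf : Monotone f) (hg : Monotone g) :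
    (∑ E ∈ powersetCard m U, f #(E ∩ A) * g #(E ∩ B)) * (#U).choose m ≤
      (∑ E ∈ powersetCard m U, f #(E ∩ A)) * (∑ E ∈ powersetCard m U, g #(E ∩ B)) := by
  have h1 := sum_powersetCard_card_inter_pair hA hB hAB m (fun i j => f i * g j)
  have h2 := sum_powersetCard_card_inter_pair hA hB hAB m (fun i _ => f i)
  have h3 := sum_powersetCard_card_inter_pair hA hB hAB m (fun _ j => g j)
  have h4 := sum_powersetCard_card_inter_pair hA hB hAB m (fun _ _ => (1 : ℝ))
  rw [sum_const, card_powersetCard, nsmul_eq_mul, mul_one] at h4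
  simp only [mul_one] at h4
  rw [h1, h2, h3, h4]
  refine sum_mul_sum_le_of_reverse_rule _ _ (fun i i' j j' hi hj => ?_) hf hg
  set C := #(U \ (A ∪ B))
  by_cases h : i' + j' ≤ m
  · rw [if_pos h, if_pos (by omega), if_pos (by omega), if_pos (by omega)]
    have key := choose_mul_choose_add_le C (m - (i' + j')) (m - (i + j')) (j' - j) (by omega)
    rw [show m - (i + j') + (j' - j) = m - (i + j) by omega,
      show m - (i' + j') + (j' - j) = m - (i' + j) by omega] at key
    have key' : (C.choose (m - (i' + j')) : ℝ) * C.choose (m - (i + j)) ≤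
      C.choose (m - (i' + j)) * C.choose (m - (i + j')) := by exact_mod_cast key
    have h0 : (0 : ℝ) ≤ (#A).choose i * (#A).choose i' * (#B).choose j * (#B).choose j' := by
      positivity
    nlinarith [mul_le_mul_of_nonneg_left key' h0]
  · rw [if_neg h]
    simp only [mul_zero]
    split_ifs <;> positivity

end Sets

/-! ### The two models as averages over edge sets -/

theorem toOuterMeasure_apply_le_one {α : Type*} (p : PMF α) (A : Set α) :
    p.toOuterMeasure A ≤ 1 := by
  rw [PMF.toOuterMeasure_apply, ← p.tsum_coe]
  exact ENNReal.tsum_le_tsum fun a => Set.indicator_le_self A p a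

theorem toReal_toOuterMeasure_chooseThen {α β : Type} [Inhabited β] {s : Finset α}
    (hs : s.Nonempty) (f : α → PMF β) (A : Set β) :
    ((chooseThen s f).toOuterMeasure A).toReal =
      (∑ a ∈ s, ((f a).toOuterMeasure A).toReal) / #s := by
  classical
  have hle : ∀ a, (f a).toOuterMeasure A ≠ ⊤ := fun a =>
    ne_top_of_le_ne_top ENNReal.one_ne_top
      (toOuterMeasure_apply_le_one (f a) A)
  rw [chooseThen, dif_pos hs, PMF.toOuterMeasure_bind_apply,
    tsum_eq_sum (s := s) (fun a ha => by simp [ha]),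
    ENNReal.toReal_sum (fun a _ => ENNReal.mul_ne_top (PMF.apply_ne_top _ _) (hle a)), sum_div]
  refine Finset.sum_congr rfl fun a ha => ?_
  rw [PMF.uniformOfFinset_apply_of_mem _ ha, ENNReal.toReal_mul, ENNReal.toReal_inv,
    ENNReal.toReal_natCast, div_eq_inv_mul]

/-- The graph on `Fin n` with a given edge set. -/
def graphOf {n : ℕ} (E : Finset (Sym2 (Fin n))) : SimpleGraph (Fin n) :=
  SimpleGraph.fromEdgeSet (E : Set (Sym2 (Fin n)))

theorem edgeSet_graphOf {n : ℕ} {E : Finset (Sym2 (Fin n))} (hE : E ⊆ allEdges n) :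
    (graphOf E).edgeSet = E := by
  ext e
  simp only [graphOf, SimpleGraph.edgeSet_fromEdgeSet, Set.mem_sdiff, mem_coe]
  refine ⟨fun h => h.1, fun h => ⟨h, ?_⟩⟩
  have := hE h
  rw [allEdges, SimpleGraph.mem_edgeFinset] at this
  exact SimpleGraph.not_isDiag_of_mem_edgeSet _ this

theorem card_allEdges (n : ℕ) : #(allEdges n) = n.choose 2 := by
  rw [allEdges, SimpleGraph.card_edgeFinset_top_eq_card_choose_two, Fintype.card_fin]

theorem card_edgesAt (n : ℕ) (v : Fin n) : #(edgesAt n v) = n - 1 := by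
  rw [edgesAt, SimpleGraph.card_incidenceFinset_eq_degree, SimpleGraph.complete_graph_degree,
    Fintype.card_fin]

theorem edgesAt_subset (n : ℕ) (v : Fin n) : edgesAt n v ⊆ allEdges n :=
  SimpleGraph.incidenceFinset_subset _ _

theorem choose_two_eq {n : ℕ} (hn : 0 < n) : n.choose 2 = (n - 1) + (n - 1).choose 2 := by
  obtain ⟨n, rfl⟩ := Nat.exists_eq_succ_of_ne_zero hn.ne'
  simp [Nat.choose_succ_succ]

/-- Average of `F` over all edge sets of size `m`, that is, expectation under `G(n, m)`. -/
noncomputable def edgeMean (n m : ℕ) (F : Finset (Sym2 (Fin n)) → ℝ) : ℝ :=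
  (∑ E ∈ powersetCard m (allEdges n), F E) / (n.choose 2).choose m

section Mean
variable {n m : ℕ} {F G : Finset (Sym2 (Fin n)) → ℝ}

theorem edgeMean_mono (h : ∀ E, F E ≤ G E) : edgeMean n m F ≤ edgeMean n m G := by
  unfold edgeMean
  gcongr with E
  exact h E

theorem edgeMean_add :
    edgeMean n m (fun E => F E + G E) = edgeMean n m F + edgeMean n m G := by
  simp only [edgeMean, sum_add_distrib, add_div]

theorem edgeMean_sub :
    edgeMean n m (fun E => F E - G E) = edgeMean n m F - edgeMean n m G := by
  simp only [edgeMean, sum_sub_distrib, sub_div]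

theorem edgeMean_const_mul (c : ℝ) :
    edgeMean n m (fun E => c * F E) = c * edgeMean n m F := by
  simp only [edgeMean, ← mul_sum, mul_div_assoc]

theorem edgeMean_sum {ι : Type*} (s : Finset ι) (F : ι → Finset (Sym2 (Fin n)) → ℝ) :
    edgeMean n m (fun E => ∑ i ∈ s, F i E) = ∑ i ∈ s, edgeMean n m (F i) := by
  simp only [edgeMean]
  rw [sum_comm, sum_div]

theorem edgeMean_const (h : m ≤ n.choose 2) (c : ℝ) : edgeMean n m (fun _ => c) = c := by
  have : ((n.choose 2).choose m : ℝ) ≠ 0 := by exact_mod_cast (Nat.choose_pos h).ne'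
  rw [edgeMean, sum_const, card_powersetCard, card_allEdges, nsmul_eq_mul,
    mul_div_cancel_left₀ _ this]

theorem edgeMean_abs_le_sqrt (h : m ≤ n.choose 2) :
    edgeMean n m (fun E => |F E|) ≤ √(edgeMean n m fun E => F E ^ 2) := by
  have h0 : (0 : ℝ) < (n.choose 2).choose m := by exact_mod_cast Nat.choose_pos h
  refine Real.le_sqrt_of_sq_le ?_
  unfold edgeMean
  have := sq_sum_le_card_mul_sum_sq (s := powersetCard m (allEdges n)) (f := fun E => |F E|)
  rw [card_powersetCard, card_allEdges] at this
  simp only [sq_abs] at this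
  rw [div_pow, div_le_div_iff₀ (by positivity) h0]
  nlinarith

/-- Under `G(n, m)`, degrees follow the hypergeometric law. -/
theorem edgeMean_degree (hn : 0 < n) (h : m ≤ n.choose 2) (v : Fin n) (f : ℕ → ℝ) :
    edgeMean n m (fun E => f #(E ∩ edgesAt n v)) = hyperMean (n - 1) ((n - 1).choose 2) m f := by
  have h0 : ((n.choose 2).choose m : ℝ) ≠ 0 := by exact_mod_cast (Nat.choose_pos h).ne'
  rw [edgeMean, sum_powersetCard_card_inter (edgesAt_subset n v), card_allEdges, card_edgesAt,
    mul_div_cancel_left₀ _ h0, choose_two_eq hn, Nat.add_sub_cancel_left]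

end Mean

theorem nullModel_apply {n m : ℕ} (h : m ≤ n.choose 2) (A : Set (SimpleGraph (Fin n))) :
    ((nullModel n m).toOuterMeasure A).toReal =
      edgeMean n m (fun E => A.indicator (fun _ => 1) (graphOf E)) := by
  classical
  set s := Finset.univ.filter fun G : SimpleGraph (Fin n) => #G.edgeFinset = m with hs
  have hmem : ∀ {E}, E ∈ powersetCard m (allEdges n) →
      (graphOf E).edgeFinset = E := by
    intro E hE
    rw [mem_powersetCard] at hE
    ext e
    rw [SimpleGraph.mem_edgeFinset, edgeSet_graphOf hE.1, mem_coe]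
  have hsum : ∀ F : SimpleGraph (Fin n) → ℝ,
      ∑ G ∈ s, F G = ∑ E ∈ powersetCard m (allEdges n), F (graphOf E) := by
    intro F
    refine Finset.sum_bij' (fun G _ => G.edgeFinset) (fun E _ => graphOf E) ?_ ?_ ?_ ?_ ?_
    · intro G hG
      rw [hs, mem_filter] at hG
      rw [mem_powersetCard]
      exact ⟨SimpleGraph.edgeFinset_mono le_top, hG.2⟩
    · intro E hE
      rw [hs, mem_filter, hmem hE]
      exact ⟨mem_univ _, (mem_powersetCard.1 hE).2⟩
    · intro G _
      simp [graphOf]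
    · intro E hE
      exact hmem hE
    · intro G _
      simp [graphOf]
  have hcard : (#s : ℝ) = (n.choose 2).choose m := by
    have := hsum (fun _ => 1)
    simpa [card_powersetCard, card_allEdges] using this
  have hne : s.Nonempty := by
    rw [← card_pos]
    have : #s = (n.choose 2).choose m := by exact_mod_cast hcard
    rw [this]; exact Nat.choose_pos h
  have key := toReal_toOuterMeasure_chooseThen hne PMF.pure A
  have e : nullModel n m = chooseThen s PMF.pure := by
    rw [nullModel, hs]
  rw [e, key, hcard, hsum, edgeMean]
  congr 1
  refine Finset.sum_congr rfl fun E _ => ?_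
  rw [PMF.toOuterMeasure_pure_apply, Set.indicator_apply]
  split_ifs <;> simp

/-- The likelihood ratio of the planted model with respect to `G(n, m)`. -/
noncomputable def likelihood (n m k : ℕ) (E : Finset (Sym2 (Fin n))) : ℝ :=
  (∑ v, starRatio (n - 1) ((n - 1).choose 2) m k #(E ∩ edgesAt n v)) / n

theorem plantedModel_apply {n m k : ℕ} (hn : 0 < n) (hk : k ≤ n - 1) (hkm : k ≤ m)
    (h : m ≤ n.choose 2) (A : Set (SimpleGraph (Fin n))) :
    ((plantedModel n k m).toOuterMeasure A).toReal =
      edgeMean n m (fun E => likelihood n m k E * A.indicator (fun _ => 1) (graphOf E)) := by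
  classical
  have hN := choose_two_eq hn
  have h0 : ((n.choose 2).choose m : ℝ) ≠ 0 := by exact_mod_cast (Nat.choose_pos h).ne'
  have h1 : ((n - 1).choose k : ℝ) ≠ 0 := by exact_mod_cast (Nat.choose_pos hk).ne'
  have h2 : ((n.choose 2 - k).choose (m - k) : ℝ) ≠ 0 := by
    exact_mod_cast (Nat.choose_pos (by omega)).ne'
  have : Nonempty (Fin n) := ⟨⟨0, hn⟩⟩
  set g : Finset (Sym2 (Fin n)) → ℝ := fun E => A.indicator (fun _ => 1) (graphOf E) with hg
  have hv : ∀ v : Fin n, ((chooseThen ((edgesAt n v).powersetCard k) fun S =>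
      chooseThen ((allEdges n \ S).powersetCard (m - k)) fun R =>
        PMF.pure (SimpleGraph.fromEdgeSet ((S ∪ R : Finset (Sym2 (Fin n))) :
          Set (Sym2 (Fin n))))).toOuterMeasure A).toReal =
      edgeMean n m (fun E =>
        starRatio (n - 1) ((n - 1).choose 2) m k #(E ∩ edgesAt n v) * g E) := by
    intro v
    rw [toReal_toOuterMeasure_chooseThen
      (powersetCard_nonempty.2 (by rw [card_edgesAt]; exact hk)), card_powersetCard, card_edgesAt]
    have hS : ∀ S ∈ powersetCard k (edgesAt n v),
        ((chooseThen ((allEdges n \ S).powersetCard (m - k)) fun R =>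
          PMF.pure (SimpleGraph.fromEdgeSet ((S ∪ R : Finset (Sym2 (Fin n))) :
          Set (Sym2 (Fin n))))).toOuterMeasure A).toReal =
        (∑ R ∈ powersetCard (m - k) (allEdges n \ S), g (S ∪ R)) /
          (n.choose 2 - k).choose (m - k) := by
      intro S hS
      rw [mem_powersetCard] at hS
      have hc : #(allEdges n \ S) = n.choose 2 - k := by
        rw [card_sdiff_of_subset (hS.1.trans (edgesAt_subset n v)), card_allEdges, hS.2]
      rw [toReal_toOuterMeasure_chooseThen (powersetCard_nonempty.2 (by rw [hc]; omega)),
        card_powersetCard, hc]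
      congr 1
      refine Finset.sum_congr rfl fun R _ => ?_
      rw [PMF.toOuterMeasure_pure_apply, hg]
      simp only [graphOf, Set.indicator_apply]
      split_ifs <;> simp
    rw [Finset.sum_congr rfl hS, ← sum_div, sum_powersetCard_sdiff (edgesAt_subset n v) hkm g,
      edgeMean, div_div, div_eq_div_iff (mul_ne_zero h2 h1) h0, sum_mul, sum_mul]
    refine Finset.sum_congr rfl fun E _ => ?_
    rw [starRatio, starWeight, ← hN, nsmul_eq_mul]
    field_simp
  rw [plantedModel, toReal_toOuterMeasure_chooseThen univ_nonempty, card_univ, Fintype.card_fin,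
    Finset.sum_congr rfl fun v _ => hv v, ← edgeMean_sum, div_eq_inv_mul, ← edgeMean_const_mul]
  congr 1
  ext E
  rw [likelihood, ← sum_mul]
  ring

/-! ### Non-asymptotic bounds on the total variation distance -/

/-- The probability that the hub of the planted star has degree at most `T`. -/
noncomputable def hubCDF (n m k T : ℕ) : ℝ :=
  hyperMean (n - 1 - k) ((n - 1).choose 2) (m - k) (fun i => if i + k ≤ T then 1 else 0)

section Bounds
variable {n m k : ℕ}

theorem hyperMean_starRatio (hn : 0 < n) (hk : k ≤ n - 1) (hkm : k ≤ m) (h : m ≤ n.choose 2) :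
    hyperMean (n - 1) ((n - 1).choose 2) m (starRatio (n - 1) ((n - 1).choose 2) m k) = 1 := by
  have hN := choose_two_eq hn
  have := hyperMean_starRatio_mul hk hkm (hN ▸ h) (fun _ => 1)
  simp only [mul_one] at this
  rw [this, hyperMean_one (by omega)]

theorem edgeMean_likelihood (hn : 0 < n) (hk : k ≤ n - 1) (hkm : k ≤ m) (h : m ≤ n.choose 2) :
    edgeMean n m (likelihood n m k) = 1 := by
  have h0 : (n : ℝ) ≠ 0 := by exact_mod_cast hn.ne'
  have e : edgeMean n m (likelihood n m k) = edgeMean n m (fun E => (n : ℝ)⁻¹ *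
      ∑ v, starRatio (n - 1) ((n - 1).choose 2) m k #(E ∩ edgesAt n v)) := by
    congr 1; ext E; rw [likelihood, div_eq_inv_mul]
  rw [e, edgeMean_const_mul, edgeMean_sum]
  simp only [edgeMean_degree hn h, hyperMean_starRatio hn hk hkm h]
  simp [h0]

/-- The total variation distance is at most the expected deficit of the likelihood ratio
from `1`. -/
theorem tvDist_le_edgeMean (hn : 0 < n) (hk : k ≤ n - 1) (hkm : k ≤ m) (h : m ≤ n.choose 2) :
    tvDist (plantedModel n k m) (nullModel n m) ≤
      edgeMean n m (fun E => max (1 - likelihood n m k E) 0) := by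
  refine ciSup_le fun A => ?_
  rw [plantedModel_apply hn hk hkm h, nullModel_apply h, abs_le]
  constructor
  · rw [neg_le, neg_sub, ← edgeMean_sub]
    refine edgeMean_mono fun E => ?_
    by_cases hA : graphOf E ∈ A
    · simp [hA]
    · simp [hA]
  · have h1 : edgeMean n m (fun E => max (1 - likelihood n m k E) 0) =
        edgeMean n m (fun E => (likelihood n m k E - 1) + max (1 - likelihood n m k E) 0) := by
      rw [edgeMean_add, edgeMean_sub, edgeMean_const h,
        show edgeMean n m (fun E => likelihood n m k E) = 1 from edgeMean_likelihood hn hk hkm h]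
      ring
    rw [← edgeMean_sub, h1]
    refine edgeMean_mono fun E => ?_
    have h2 := le_max_left (1 - likelihood n m k E) 0
    have h3 := le_max_right (1 - likelihood n m k E) 0
    by_cases hA : graphOf E ∈ A
    · simp only [hA, Set.indicator_of_mem]; linarith
    · simp only [hA, not_false_eq_true, Set.indicator_of_notMem]; linarith

theorem le_tvDist {Ω : Type} (P Q : PMF Ω) (A : Set Ω) :
    (P.toOuterMeasure A).toReal - (Q.toOuterMeasure A).toReal ≤ tvDist P Q := by
  have hb : ∀ (R : PMF Ω) (B : Set Ω), 0 ≤ (R.toOuterMeasure B).toReal ∧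
      (R.toOuterMeasure B).toReal ≤ 1 := fun R B =>
    ⟨ENNReal.toReal_nonneg, ENNReal.toReal_le_of_le_ofReal zero_le_one
      (by simpa using toOuterMeasure_apply_le_one R B)⟩
  refine (le_abs_self _).trans (le_ciSup (f := fun A : Set Ω =>
    |(P.toOuterMeasure A).toReal - (Q.toOuterMeasure A).toReal|) ⟨1, ?_⟩ A)
  rintro _ ⟨B, rfl⟩
  have h1 := hb P B
  have h2 := hb Q B
  simp only [abs_le]
  constructor <;> linarith

/-- The distribution function of the hub degree, written as an expectation under the null law. -/
theorem hyperMean_starRatio_le (hn : 0 < n) (hk : k ≤ n - 1) (hkm : k ≤ m) (h : m ≤ n.choose 2)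
    (T : ℕ) :
    hyperMean (n - 1) ((n - 1).choose 2) m (fun i =>
      starRatio (n - 1) ((n - 1).choose 2) m k i * if i ≤ T then 1 else 0) = hubCDF n m k T := by
  rw [hyperMean_starRatio_mul hk hkm (choose_two_eq hn ▸ h), hubCDF]

/-- Testing whether some degree exceeds `T`: the planted hub does so with probability
`1 - hubCDF n m k T`, while a union bound and the likelihood ratio at `T` control the null. -/
theorem one_sub_hubCDF_sub_le_tvDist (hn : 0 < n) (hk : k ≤ n - 1) (hkm : k ≤ m)
    (h : m ≤ n.choose 2) {T : ℕ} (hT : 0 < starRatio (n - 1) ((n - 1).choose 2) m k T) :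
    1 - hubCDF n m k T - n / starRatio (n - 1) ((n - 1).choose 2) m k T ≤
      tvDist (plantedModel n k m) (nullModel n m) := by
  classical
  have h0 : (0 : ℝ) < n := by exact_mod_cast hn
  set ℓ := starRatio (n - 1) ((n - 1).choose 2) m k with hℓ
  set A : Set (SimpleGraph (Fin n)) :=
    {G | ∃ v, T < #((edgesAt n v).filter (· ∈ G.edgeSet))} with hA
  have hAE : ∀ E ∈ powersetCard m (allEdges n),
      (graphOf E ∈ A ↔ ∃ v, T < #(E ∩ edgesAt n v)) := by
    intro E hE
    rw [mem_powersetCard] at hE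
    have : ∀ v, (edgesAt n v).filter (· ∈ (graphOf E).edgeSet) = E ∩ edgesAt n v := by
      intro v
      ext e
      rw [mem_filter, edgeSet_graphOf hE.1, mem_inter, mem_coe, and_comm]
    simp only [hA, Set.mem_ofPred_eq, this]
  have hcongr : ∀ F G : Finset (Sym2 (Fin n)) → ℝ,
      (∀ E ∈ powersetCard m (allEdges n), F E ≤ G E) → edgeMean n m F ≤ edgeMean n m G := by
    intro F G hFG
    exact div_le_div_of_nonneg_right (sum_le_sum hFG) (Nat.cast_nonneg _)
  have hplant : 1 - hubCDF n m k T ≤ ((plantedModel n k m).toOuterMeasure A).toReal := by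
    rw [plantedModel_apply hn hk hkm h]
    have e1 : edgeMean n m (fun E => (n : ℝ)⁻¹ * ∑ v, (fun i => ℓ i - ℓ i * if i ≤ T then 1 else 0)
        #(E ∩ edgesAt n v)) = 1 - hubCDF n m k T := by
      rw [edgeMean_const_mul, edgeMean_sum]
      simp only [edgeMean_degree hn h (f := fun i => ℓ i - ℓ i * if i ≤ T then 1 else 0)]
      rw [hyperMean_sub, hyperMean_starRatio_le hn hk hkm h,
        show hyperMean (n - 1) ((n - 1).choose 2) m (fun i => ℓ i) = 1 from
          hyperMean_starRatio hn hk hkm h]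
      rw [sum_const, card_univ, Fintype.card_fin, nsmul_eq_mul, inv_mul_cancel_left₀ h0.ne']
    rw [← e1]
    refine hcongr _ _ fun E hE => ?_
    by_cases hEA : graphOf E ∈ A
    · simp only [hEA, Set.indicator_of_mem, mul_one, likelihood]
      rw [div_eq_inv_mul]
      gcongr with v
      rw [sub_le_self_iff]
      exact mul_nonneg (starRatio_nonneg _) (by split_ifs <;> norm_num)
    · have := (hAE E hE).not.1 hEA
      push Not at this
      simp only [hEA, not_false_eq_true, Set.indicator_of_notMem, mul_zero]
      simp [this]
  have hnull : ((nullModel n m).toOuterMeasure A).toReal ≤ n / ℓ T := by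
    rw [nullModel_apply h]
    have e1 : edgeMean n m (fun E => (ℓ T)⁻¹ * ∑ v, ℓ #(E ∩ edgesAt n v)) = n / ℓ T := by
      rw [edgeMean_const_mul, edgeMean_sum]
      simp only [edgeMean_degree hn h]
      rw [hyperMean_starRatio hn hk hkm h]
      simp [div_eq_inv_mul]
    rw [← e1]
    refine hcongr _ _ fun E hE => ?_
    have hnn : 0 ≤ ∑ v, ℓ #(E ∩ edgesAt n v) := sum_nonneg fun _ _ => starRatio_nonneg _
    by_cases hEA : graphOf E ∈ A
    · obtain ⟨v, hv⟩ := (hAE E hE).1 hEA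
      simp only [hEA, Set.indicator_of_mem]
      rw [← div_eq_inv_mul, one_le_div hT]
      exact (starRatio_mono _ _ _ _ hv.le).trans (single_le_sum
        (f := fun v => ℓ #(E ∩ edgesAt n v)) (fun _ _ => starRatio_nonneg _) (mem_univ v))
    · simp only [hEA, not_false_eq_true, Set.indicator_of_notMem]
      positivity
  have := le_tvDist (plantedModel n k m) (nullModel n m) A
  linarith

/-- The likelihood ratio of a single hub, truncated at its value for degree `T`. Unlike a cut-off
by an indicator, this keeps it an increasing function of the degree. -/
noncomputable def truncRatio (n m k T j : ℕ) : ℝ :=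
  min (starRatio (n - 1) ((n - 1).choose 2) m k j) (starRatio (n - 1) ((n - 1).choose 2) m k T)

theorem truncRatio_mono (n m k T : ℕ) : Monotone (truncRatio n m k T) := fun _ _ hij =>
  min_le_min_right _ (starRatio_mono _ _ _ _ hij)

theorem truncRatio_nonneg (T j : ℕ) : 0 ≤ truncRatio n m k T j :=
  le_min (starRatio_nonneg _) (starRatio_nonneg _)

/-- The part of the sample space containing a given edge at `v` contributes little: planting makes
the edge present with probability at most `k / (n - 1)` plus the edge density. -/
theorem sum_truncRatio_insert_le (hn : 2 ≤ n) (hk : k ≤ n - 1) (hkm : k ≤ m + 1)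
    (h : m + 1 ≤ n.choose 2) (T : ℕ) {e : Sym2 (Fin n)} {v : Fin n} (he : e ∈ edgesAt n v) :
    ∑ E ∈ powersetCard m ((allEdges n).erase e),
        truncRatio n (m + 1) k T (#(E ∩ (edgesAt n v).erase e) + 1) ≤
      (n.choose 2).choose (m + 1) *
        ((k : ℝ) / (n - 1 : ℕ) + ((m + 1 : ℕ) : ℝ) / n.choose 2) := by
  have hN := choose_two_eq (show 0 < n by omega)
  rw [sum_powersetCard_card_inter (erase_subset_erase _ (edgesAt_subset n v)) m
    (fun i => truncRatio n (m + 1) k T (i + 1)), card_erase_of_mem (edgesAt_subset n v he),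
    card_erase_of_mem he, card_allEdges, card_edgesAt]
  obtain ⟨K, hK⟩ : ∃ K, n - 1 = K + 1 := ⟨n - 2, by omega⟩
  have hs := hyperMean_succ (K := K) (B := (n - 1).choose 2) (m := m)
    (truncRatio n (m + 1) k T) (by omega)
  rw [← hK, ← hN] at hs
  have e1 : n.choose 2 - 1 - (n - 1 - 1) = (n - 1).choose 2 := by omega
  have e2 : n.choose 2 - 1 = K + (n - 1).choose 2 := by omega
  have hc : ((n.choose 2).choose (m + 1) : ℝ) ≠ 0 := by exact_mod_cast (Nat.choose_pos h).ne'
  have hKpos : (0 : ℝ) < (n - 1 : ℕ) := by exact_mod_cast (show 0 < n - 1 by omega)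
  rw [eq_div_iff hc] at hs
  rw [e1, e2, show n - 1 - 1 = K by omega, mul_comm, ← hs, mul_comm]
  refine mul_le_mul_of_nonneg_left ?_ (Nat.cast_nonneg _)
  rw [div_le_iff₀ hKpos]
  have h1 : hyperMean (n - 1) ((n - 1).choose 2) (m + 1)
      (fun i => (i : ℝ) * truncRatio n (m + 1) k T i) ≤
      hyperMean (n - 1) ((n - 1).choose 2) (m + 1)
        (fun i => starRatio (n - 1) ((n - 1).choose 2) (m + 1) k i * i) := by
    refine hyperMean_mono fun i _ _ => ?_
    rw [mul_comm]
    exact mul_le_mul_of_nonneg_right (min_le_left _ _) (Nat.cast_nonneg _)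
  refine h1.trans ?_
  have hN0 : 0 < n.choose 2 := by omega
  have hid : hyperMean (n - 1 - k) ((n - 1).choose 2) (m + 1 - k) (fun i => (i : ℝ)) ≤
      ((n - 1 : ℕ) : ℝ) * ((m + 1 : ℕ) / n.choose 2) := by
    rcases Nat.eq_zero_or_pos (n - 1 - k + (n - 1).choose 2) with hz | hz
    · have hz1 : n - 1 - k = 0 := by omega
      have hz2 : hyperMean (n - 1 - k) ((n - 1).choose 2) (m + 1 - k) (fun i => (i : ℝ)) =
          hyperMean (n - 1 - k) ((n - 1).choose 2) (m + 1 - k) (fun i => (0 : ℝ)) :=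
        hyperMean_congr fun i _ hi => by
          have : i = 0 := by omega
          simp [this]
      rw [hz2]
      simp only [hyperMean, mul_zero, sum_const_zero, zero_div]
      positivity
    rw [hyperMean_id (by omega) hz, mul_div_assoc]
    have hc1 : ((n - 1 - k : ℕ) : ℝ) ≤ (n - 1 : ℕ) := by exact_mod_cast Nat.sub_le _ _
    refine mul_le_mul hc1 ?_ (by positivity) (by positivity)
    rw [div_le_div_iff₀ (by exact_mod_cast hz) (by exact_mod_cast hN0)]
    have e3 : n - 1 - k + (n - 1).choose 2 = n.choose 2 - k := by omega
    rw [e3]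
    have : (m + 1 - k) * n.choose 2 ≤ (m + 1) * (n.choose 2 - k) := by
      obtain ⟨a, ha⟩ := Nat.exists_eq_add_of_le h
      obtain ⟨b, hb⟩ := Nat.exists_eq_add_of_le hkm
      rw [ha, hb, Nat.add_sub_cancel_left, show k + b + a - k = b + a by omega]
      nlinarith [Nat.zero_le (k * a)]
    exact_mod_cast this
  rw [hyperMean_starRatio_mul hk hkm (hN ▸ h) (fun i => (i : ℝ))]
  simp only [Nat.cast_add]
  rw [hyperMean_add]
  have hcst : hyperMean (n - 1 - k) ((n - 1).choose 2) (m + 1 - k) (fun _ => (k : ℝ)) = k := by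
    have := hyperMean_const_mul (n - 1 - k) ((n - 1).choose 2) (m + 1 - k) (k : ℝ) (fun _ => 1)
    rw [hyperMean_one (by omega)] at this
    simpa using this
  rw [hcst, add_mul, div_mul_cancel₀ _ hKpos.ne']
  push_cast at hid ⊢
  linarith

theorem edgesAt_inter_edgesAt {u v : Fin n} (huv : u ≠ v) :
    edgesAt n u ∩ edgesAt n v = {s(u, v)} := by
  ext e
  simp only [edgesAt, mem_inter, SimpleGraph.mem_incidenceFinset, mem_singleton]
  constructor
  · rintro ⟨h1, h2⟩
    exact (Sym2.mem_and_mem_iff huv).1 ⟨h1.2, h2.2⟩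
  · rintro rfl
    simp [SimpleGraph.incidenceSet, huv]

/-- Second moment of a pair of truncated likelihood ratios. Conditionally on the status of the edge
joining the two vertices, the degrees are negatively correlated. -/
theorem edgeMean_truncRatio_mul_le (hn : 2 ≤ n) (hk : k ≤ n - 1) (hk0 : 0 < k) (hkm : k ≤ m)
    (h : m < n.choose 2) (T : ℕ) {u v : Fin n} (huv : u ≠ v) :
    edgeMean n m (fun E => truncRatio n m k T #(E ∩ edgesAt n u) *
        truncRatio n m k T #(E ∩ edgesAt n v)) ≤
      hyperMean (n - 1) ((n - 1).choose 2) m (truncRatio n m k T) ^ 2 /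
          (1 - (m : ℝ) / n.choose 2) +
        ((k : ℝ) / (n - 1 : ℕ) + (m : ℝ) / n.choose 2) ^ 2 / ((m : ℝ) / n.choose 2) := by
  obtain ⟨m, rfl⟩ := Nat.exists_eq_succ_of_ne_zero (show m ≠ 0 by omega)
  rw [Nat.succ_eq_add_one] at *
  set f := truncRatio n (m + 1) k T with hf
  set N := n.choose 2 with hNdef
  set μ := hyperMean (n - 1) ((n - 1).choose 2) (m + 1) f with hμ
  have hfm : Monotone f := truncRatio_mono _ _ _ _
  set e : Sym2 (Fin n) := s(u, v) with he
  have hI := edgesAt_inter_edgesAt huv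
  have heu : e ∈ edgesAt n u := (mem_inter.1 (hI ▸ mem_singleton_self e)).1
  have hev : e ∈ edgesAt n v := (mem_inter.1 (hI ▸ mem_singleton_self e)).2
  set W := (allEdges n).erase e with hW
  have hU : insert e W = allEdges n := insert_erase (edgesAt_subset n u heu)
  have hdisj : Disjoint ((edgesAt n u).erase e) ((edgesAt n v).erase e) := by
    rw [disjoint_left]
    intro a ha hb
    rw [mem_erase] at ha hb
    exact ha.1 (mem_singleton.1 (hI ▸ mem_inter.2 ⟨ha.2, hb.2⟩))
  have hWc : #W = N - 1 := by
    rw [hW, card_erase_of_mem (edgesAt_subset n u heu), card_allEdges]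
  have hsu : ∀ w, (edgesAt n w).erase e ⊆ W := fun w => erase_subset_erase _ (edgesAt_subset n w)
  have hc : (0 : ℝ) < N.choose (m + 1) := by exact_mod_cast Nat.choose_pos h.le
  have hNpos : (0 : ℝ) < N := by exact_mod_cast (show 0 < N by omega)
  have hNs : N = N - 1 + 1 := by omega
  have hq1 : (0 : ℝ) < 1 - ((m + 1 : ℕ) : ℝ) / N := by
    rw [sub_pos, div_lt_one hNpos]; exact_mod_cast h
  have hq0 : (0 : ℝ) < ((m + 1 : ℕ) : ℝ) / N := by positivity
  have hc0 : ((N - 1).choose (m + 1) : ℝ) = N.choose (m + 1) * (1 - ((m + 1 : ℕ) : ℝ) / N) := by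
    have h1 := Nat.choose_mul_succ_eq (N - 1) (m + 1)
    rw [← hNs] at h1
    have h2 : ((N - 1).choose (m + 1) : ℝ) * N = N.choose (m + 1) * ((N : ℝ) - (m + 1 : ℕ)) := by
      rw [← Nat.cast_sub h.le]; exact_mod_cast h1
    field_simp
    linarith
  have hc1 : ((N - 1).choose m : ℝ) = N.choose (m + 1) * (((m + 1 : ℕ) : ℝ) / N) := by
    have h1 := Nat.add_one_mul_choose_eq (N - 1) m
    rw [← hNs] at h1
    have h2 : (N : ℝ) * (N - 1).choose m = N.choose (m + 1) * ((m + 1 : ℕ) : ℝ) := by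
      exact_mod_cast h1
    field_simp
    linarith
  have hout : ∀ w, e ∈ edgesAt n w → ∀ E ⊆ W, E ∩ edgesAt n w = E ∩ (edgesAt n w).erase e := by
    intro w _ E hE
    ext a
    simp only [mem_inter, mem_erase]
    refine ⟨fun ha => ⟨ha.1, fun hae => ?_, ha.2⟩, fun ha => ⟨ha.1, ha.2.2⟩⟩
    have := hE ha.1
    rw [hae] at this
    exact notMem_erase e _ this
  have hin : ∀ w, e ∈ edgesAt n w → ∀ E ⊆ W,
      #(insert e E ∩ edgesAt n w) = #(E ∩ (edgesAt n w).erase e) + 1 := by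
    intro w hw E hE
    rw [insert_inter_of_mem hw, hout w hw E hE, card_insert_of_notMem]
    simp
  have hsplit : ∀ G : Finset (Sym2 (Fin n)) → ℝ, ∑ E ∈ powersetCard (m + 1) (allEdges n), G E =
      ∑ E ∈ powersetCard (m + 1) W, G E + ∑ E ∈ powersetCard m W, G (insert e E) := by
    intro G
    rw [← hU, powersetCard_succ_insert (notMem_erase e _), sum_union, sum_image]
    · intro E hE E' hE' hEE
      have h1 : e ∉ E := fun h => notMem_erase e _ ((mem_powersetCard.1 hE).1 h)
      have h2 : e ∉ E' := fun h => notMem_erase e _ ((mem_powersetCard.1 hE').1 h)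
      rw [← erase_insert h1, ← erase_insert h2]
      exact congrArg (fun s => s.erase e) hEE
    · rw [disjoint_left]
      intro E hE hE'
      obtain ⟨E', _, rfl⟩ := mem_image.1 hE'
      exact notMem_erase e _ ((mem_powersetCard.1 hE).1 (mem_insert_self e E'))
  -- Edge sets without `e` have total mass `1 - m / N`; there the degrees of `u` and `v` are
  -- intersections with disjoint sets.
  have hS0 : ∀ w, e ∈ edgesAt n w →
      ∑ E ∈ powersetCard (m + 1) W, f #(E ∩ (edgesAt n w).erase e) ≤ N.choose (m + 1) * μ := by
    intro w hw
    have h1 := edgeMean_degree (show 0 < n by omega) h.le w f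
    rw [edgeMean, div_eq_iff hc.ne', ← hμ, mul_comm] at h1
    rw [← h1, hsplit]
    have h2 : ∑ E ∈ powersetCard (m + 1) W, f #(E ∩ (edgesAt n w).erase e) =
        ∑ E ∈ powersetCard (m + 1) W, f #(E ∩ edgesAt n w) :=
      Finset.sum_congr rfl fun E hE => by rw [hout w hw E (mem_powersetCard.1 hE).1]
    rw [h2]
    exact le_add_of_nonneg_right (sum_nonneg fun _ _ => truncRatio_nonneg _ _)
  have hA : ∑ E ∈ powersetCard (m + 1) W, f #(E ∩ edgesAt n u) * f #(E ∩ edgesAt n v) ≤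
      N.choose (m + 1) * (μ ^ 2 / (1 - ((m + 1 : ℕ) : ℝ) / N)) := by
    have h1 := sum_powersetCard_mul_le (hsu u) (hsu v) hdisj (m + 1) hfm hfm
    have h2 := mul_le_mul (hS0 u heu) (hS0 v hev) (sum_nonneg fun _ _ => truncRatio_nonneg _ _)
      (mul_nonneg hc.le (hyperMean_nonneg fun _ => truncRatio_nonneg _ _))
    rw [hWc, hc0] at h1
    have h3 : ∑ E ∈ powersetCard (m + 1) W, f #(E ∩ edgesAt n u) * f #(E ∩ edgesAt n v) =
        ∑ E ∈ powersetCard (m + 1) W, f #(E ∩ (edgesAt n u).erase e) *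
          f #(E ∩ (edgesAt n v).erase e) :=
      Finset.sum_congr rfl fun E hE => by
        rw [hout u heu E (mem_powersetCard.1 hE).1, hout v hev E (mem_powersetCard.1 hE).1]
    rw [h3, ← mul_div_assoc, le_div_iff₀ hq1]
    refine le_of_mul_le_mul_right ?_ hc
    calc _ = _ := by ring
      _ ≤ _ := h1.trans h2
      _ = _ := by ring
  -- Edge sets with `e` have total mass `m / N`; again negative correlation applies, now to the
  -- degrees without the common edge.
  have hB : ∑ E ∈ powersetCard m W, f #(insert e E ∩ edgesAt n u) *
      f #(insert e E ∩ edgesAt n v) ≤ N.choose (m + 1) *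
        (((k : ℝ) / (n - 1 : ℕ) + ((m + 1 : ℕ) : ℝ) / N) ^ 2 / (((m + 1 : ℕ) : ℝ) / N)) := by
    have hfm' : Monotone fun i => f (i + 1) := fun i j hij => hfm (by omega)
    have h1 := sum_powersetCard_mul_le (hsu u) (hsu v) hdisj m hfm' hfm'
    have h2 := mul_le_mul (sum_truncRatio_insert_le hn hk hkm h.le T heu)
      (sum_truncRatio_insert_le hn hk hkm h.le T hev)
      (sum_nonneg fun _ _ => truncRatio_nonneg _ _) (by positivity)
    rw [hWc, hc1] at h1
    have h3 : ∑ E ∈ powersetCard m W, f #(insert e E ∩ edgesAt n u) *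
        f #(insert e E ∩ edgesAt n v) =
        ∑ E ∈ powersetCard m W, f (#(E ∩ (edgesAt n u).erase e) + 1) *
          f (#(E ∩ (edgesAt n v).erase e) + 1) :=
      Finset.sum_congr rfl fun E hE => by
        rw [hin u heu E (mem_powersetCard.1 hE).1, hin v hev E (mem_powersetCard.1 hE).1]
    rw [h3, ← mul_div_assoc, le_div_iff₀ hq0]
    refine le_of_mul_le_mul_right ?_ hc
    calc _ = _ := by ring
      _ ≤ _ := h1.trans h2
      _ = _ := by ring
  rw [edgeMean, div_le_iff₀ hc, hsplit]
  linarith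

/-- Bounding the likelihood ratio from below by its truncation at `T`: the mean of the truncation is
at least `hubCDF n m k T`, and the square root bounds its standard deviation. -/
theorem tvDist_le_one_sub_hubCDF_add (hn : 2 ≤ n) (hk : k ≤ n - 1) (hk0 : 0 < k) (hkm : k ≤ m)
    (h : m < n.choose 2) (T : ℕ) :
    tvDist (plantedModel n k m) (nullModel n m) ≤ 1 - hubCDF n m k T +
      √(starRatio (n - 1) ((n - 1).choose 2) m k T / n +
        ((m : ℝ) / n.choose 2) / (1 - (m : ℝ) / n.choose 2) +
        ((k : ℝ) / (n - 1 : ℕ) + (m : ℝ) / n.choose 2) ^ 2 / ((m : ℝ) / n.choose 2)) := by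
  have hn0 : 0 < n := by omega
  have hnR : (0 : ℝ) < n := by exact_mod_cast hn0
  set q := (m : ℝ) / n.choose 2 with hq
  set f := truncRatio n m k T with hf
  set ℓ := starRatio (n - 1) ((n - 1).choose 2) m k with hℓ
  set μ := hyperMean (n - 1) ((n - 1).choose 2) m f with hμ
  have hq1 : 0 < 1 - q := by
    rw [hq, sub_pos, div_lt_one (by exact_mod_cast (show 0 < n.choose 2 by omega))]
    exact_mod_cast h
  have hμ0 : 0 ≤ μ := hyperMean_nonneg fun _ => truncRatio_nonneg _ _
  have hμ1 : μ ≤ 1 := by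
    rw [← hyperMean_starRatio hn0 hk hkm h.le]
    exact hyperMean_mono fun i _ _ => min_le_left _ _
  have hμH : hubCDF n m k T ≤ μ := by
    rw [← hyperMean_starRatio_le hn0 hk hkm h.le]
    refine hyperMean_mono fun i _ _ => ?_
    split_ifs with hi
    · rw [mul_one]; exact le_min le_rfl (starRatio_mono _ _ _ _ hi)
    · rw [mul_zero]; exact truncRatio_nonneg _ _
  set L : Finset (Sym2 (Fin n)) → ℝ := fun E => (n : ℝ)⁻¹ * ∑ v, f #(E ∩ edgesAt n v) with hL
  have hLle : ∀ E, L E ≤ likelihood n m k E := by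
    intro E
    rw [likelihood, div_eq_inv_mul]
    exact mul_le_mul_of_nonneg_left (sum_le_sum fun v _ => min_le_left _ _) (by positivity)
  have hLmean : edgeMean n m L = μ := by
    rw [hL, edgeMean_const_mul, edgeMean_sum]
    simp only [edgeMean_degree hn0 h.le]
    simp [hμ, hnR.ne']
  set R := ((k : ℝ) / (n - 1 : ℕ) + q) ^ 2 / q with hR
  have hpair : ∀ u v : Fin n, edgeMean n m (fun E => f #(E ∩ edgesAt n u) * f #(E ∩ edgesAt n v)) ≤
      (if u = v then ℓ T else 0) + (μ ^ 2 / (1 - q) + R) := by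
    intro u v
    split_ifs with huv
    · subst huv
      have h1 : edgeMean n m (fun E => f #(E ∩ edgesAt n u) * f #(E ∩ edgesAt n u)) ≤
          edgeMean n m (fun E => ℓ T * f #(E ∩ edgesAt n u)) :=
        edgeMean_mono fun E => mul_le_mul_of_nonneg_right (min_le_right _ _)
          (truncRatio_nonneg _ _)
      rw [edgeMean_const_mul, edgeMean_degree hn0 h.le] at h1
      have h2 : ℓ T * μ ≤ ℓ T := mul_le_of_le_one_right (starRatio_nonneg _) hμ1
      have h3 : 0 ≤ μ ^ 2 / (1 - q) + R := by positivity
      linarith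
    · rw [zero_add]
      exact edgeMean_truncRatio_mul_le hn hk hk0 hkm h T huv
  have hsq : edgeMean n m (fun E => L E ^ 2) ≤ ℓ T / n + (μ ^ 2 / (1 - q) + R) := by
    have e1 : (fun E => L E ^ 2) = fun E => ((n : ℝ)⁻¹ ^ 2) *
        ∑ u, ∑ v, f #(E ∩ edgesAt n u) * f #(E ∩ edgesAt n v) := by
      ext E
      rw [hL, mul_pow, sq (∑ v, _), sum_mul_sum]
    rw [e1, edgeMean_const_mul, edgeMean_sum]
    simp only [edgeMean_sum]
    have h1 : ∑ u : Fin n, ∑ v : Fin n,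
        edgeMean n m (fun E => f #(E ∩ edgesAt n u) * f #(E ∩ edgesAt n v)) ≤
        ∑ u : Fin n, ∑ v : Fin n, ((if u = v then ℓ T else 0) + (μ ^ 2 / (1 - q) + R)) :=
      sum_le_sum fun u _ => sum_le_sum fun v _ => hpair u v
    have h2 : ∑ u : Fin n, ∑ v : Fin n, ((if u = v then ℓ T else 0) + (μ ^ 2 / (1 - q) + R)) =
        n * ℓ T + (n : ℝ) ^ 2 * (μ ^ 2 / (1 - q) + R) := by
      simp only [sum_add_distrib, sum_ite_eq, mem_univ, if_true, sum_const, card_univ,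
        Fintype.card_fin, nsmul_eq_mul]
      ring
    rw [h2] at h1
    calc _ ≤ ((n : ℝ)⁻¹ ^ 2) * (n * ℓ T + (n : ℝ) ^ 2 * (μ ^ 2 / (1 - q) + R)) :=
          mul_le_mul_of_nonneg_left h1 (by positivity)
      _ = _ := by field_simp
  have hvar : edgeMean n m (fun E => (L E - μ) ^ 2) ≤ ℓ T / n + q / (1 - q) + R := by
    have e1 : (fun E => (L E - μ) ^ 2) = fun E => (L E ^ 2 - (2 * μ) * L E) + μ ^ 2 := by
      ext E; ring
    rw [e1, edgeMean_add, edgeMean_sub, edgeMean_const_mul, edgeMean_const h.le, hLmean]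
    have h1 : μ ^ 2 / (1 - q) - μ ^ 2 ≤ q / (1 - q) := by
      have h2 : μ ^ 2 / (1 - q) - μ ^ 2 = μ ^ 2 * (q / (1 - q)) := by field_simp; ring
      rw [h2]
      exact mul_le_of_le_one_left (by positivity) (pow_le_one₀ hμ0 hμ1)
    linarith
  calc _ ≤ edgeMean n m (fun E => max (1 - likelihood n m k E) 0) :=
        tvDist_le_edgeMean hn0 hk hkm h.le
    _ ≤ edgeMean n m (fun E => (1 - μ) + |L E - μ|) := by
        refine edgeMean_mono fun E => max_le ?_ (by positivity)
        have := neg_abs_le (L E - μ)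
        have := hLle E
        linarith
    _ = (1 - μ) + edgeMean n m (fun E => |L E - μ|) := by
        rw [edgeMean_add, edgeMean_const h.le]
    _ ≤ (1 - μ) + √(edgeMean n m fun E => (L E - μ) ^ 2) := by
        gcongr; exact edgeMean_abs_le_sqrt h.le
    _ ≤ _ := by gcongr

end Bounds

/-! ### Central limit theorem for the hypergeometric law -/

section CLT
open MeasureTheory

theorem norm_hyperMean_le {K B m : ℕ} {f : ℕ → ℂ} {b : ℕ → ℝ}
    (h : ∀ i ≤ m, i ≤ K → ‖f i‖ ≤ b i) : ‖hyperMean K B m f‖ ≤ hyperMean K B m b := by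
  unfold hyperMean
  rw [norm_div, Complex.norm_natCast]
  refine div_le_div_of_nonneg_right ?_ (Nat.cast_nonneg _)
  refine (norm_sum_le _ _).trans (sum_le_sum fun p hp => ?_)
  rw [norm_mul, norm_mul, Complex.norm_natCast, Complex.norm_natCast]
  by_cases hK : p.1 ≤ K
  · exact mul_le_mul_of_nonneg_left (h p.1 (by have := mem_antidiagonal.1 hp; omega) hK)
      (by positivity)
  · rw [Nat.choose_eq_zero_of_lt (not_le.1 hK)]; simp

theorem hasDerivAt_hyperMean {K B m : ℕ} {f : ℝ → ℕ → ℂ} {f' : ℕ → ℂ} {s : ℝ}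
    (h : ∀ i, HasDerivAt (fun s => f s i) (f' i) s) :
    HasDerivAt (fun s => hyperMean K B m (f s)) (hyperMean K B m f') s := by
  unfold hyperMean
  exact (HasDerivAt.fun_sum fun p _ => (h p.1).const_mul _).div_const _

/-- Characteristic function of a hypergeometric variable, centred at its mean and divided by `σ`. -/
noncomputable def hyperChar (K B m : ℕ) (σ s : ℝ) : ℂ :=
  hyperMean K B m fun i => Complex.exp (((s * ((i - K * m / (K + B : ℕ)) / σ) : ℝ) : ℂ) * Complex.I)

/-- Relative error in replacing the Stein kernel of the hypergeometric law by the constant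
`σ ^ 2`. -/
noncomputable def steinError (K B m : ℕ) (σ : ℝ) : ℝ :=
  ((2 * K + m) / (K + B : ℕ) * (K * m / (K + B : ℕ)) + |K * m / (K + B : ℕ) - σ ^ 2|) / σ ^ 2

theorem steinError_nonneg (K B m : ℕ) (σ : ℝ) : 0 ≤ steinError K B m σ := by
  unfold steinError; positivity

theorem norm_hyperMean_stein_le {K B m : ℕ} (h : m ≤ K + B) (h0 : 0 < K + B) {σ s : ℝ}
    (hσ : 0 < σ) (hs : |s| ≤ σ) :
    ‖hyperMean K B m (fun i => (((i - K * m / (K + B : ℕ)) / σ : ℝ) : ℂ) *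
        Complex.exp (((s * ((i - K * m / (K + B : ℕ)) / σ) : ℝ) : ℂ) * Complex.I)) -
      Complex.I * s * hyperChar K B m σ s‖ ≤ |s| * steinError K B m σ + s ^ 2 / σ := by
  set N : ℝ := ((K + B : ℕ) : ℝ) with hN
  have hNpos : 0 < N := by rw [hN]; exact_mod_cast h0
  set μ : ℝ := K * m / N with hμ
  set w : ℕ → ℂ := fun i => Complex.exp (((s * ((i - μ) / σ) : ℝ) : ℂ) * Complex.I) with hw
  set z : ℂ := Complex.exp (Complex.I * ((s / σ : ℝ) : ℂ)) with hz
  have hNC : ((K + B : ℕ) : ℂ) = (N : ℂ) := by rw [hN]; simp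
  have hN0 : (N : ℂ) ≠ 0 := by exact_mod_cast hNpos.ne'
  have hσ0 : (σ : ℂ) ≠ 0 := by exact_mod_cast hσ.ne'
  have hw1 : ∀ i, w (i + 1) = w i * z := by
    intro i
    simp only [hw, hz]
    rw [← Complex.exp_add]
    congr 1
    push_cast
    field_simp
    ring
  have hwn : ∀ i, ‖w i‖ = 1 := fun i => Complex.norm_exp_ofReal_mul_I _
  have hz1 : ‖z - 1‖ ≤ |s| / σ := by
    refine Real.norm_exp_I_mul_ofReal_sub_one_le.trans ?_
    rw [Real.norm_eq_abs, abs_div, abs_of_pos hσ]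
  have hz2 : ‖z - 1 - Complex.I * ((s / σ : ℝ) : ℂ)‖ ≤ s ^ 2 / σ ^ 2 := by
    have e : ‖Complex.I * ((s / σ : ℝ) : ℂ)‖ = |s| / σ := by
      rw [norm_mul, Complex.norm_I, one_mul, Complex.norm_real, Real.norm_eq_abs, abs_div,
        abs_of_pos hσ]
    have := Complex.norm_exp_sub_one_sub_id_le (x := Complex.I * ((s / σ : ℝ) : ℂ))
      (by rw [e, div_le_one hσ]; exact hs)
    rwa [e, div_pow, sq_abs] at this
  have key : hyperMean K B m (fun i => (((i - μ) / σ : ℝ) : ℂ) * w i) =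
      hyperMean K B m (fun i => ((K : ℂ) - i) * ((m : ℂ) - i) / (N * σ) * (z - 1) * w i) := by
    have hst := hyperMean_stein (𝕜 := ℂ) K B m w
    rw [hNC] at hst
    have e1 : (fun i : ℕ => (((i - μ) / σ : ℝ) : ℂ) * w i) =
        fun i : ℕ => (1 / (N * σ) : ℂ) * (((N : ℂ) * i - K * m) * w i) := by
      ext i
      rw [hμ]
      push_cast
      field_simp
    have e2 : (fun i : ℕ => ((K : ℂ) - i) * ((m : ℂ) - i) / (N * σ) * (z - 1) * w i) =
        fun i : ℕ => (1 / (N * σ) : ℂ) * (((K : ℂ) - i) * ((m : ℂ) - i) * (w (i + 1) - w i)) := by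
      ext i
      rw [hw1]
      field_simp
    rw [e1, e2, hyperMean_const_mul, hyperMean_const_mul, hst]
  have key2 : hyperMean K B m (fun i => (((i - μ) / σ : ℝ) : ℂ) * w i) -
      Complex.I * s * hyperChar K B m σ s =
      hyperMean K B m (fun i => ((((K - i) * (m - i) / N - σ ^ 2 : ℝ) : ℂ) / σ * (z - 1) +
        σ * (z - 1 - Complex.I * ((s / σ : ℝ) : ℂ))) * w i) := by
    rw [key, show hyperChar K B m σ s = hyperMean K B m w from rfl, ← hyperMean_const_mul,
      ← hyperMean_sub]
    congr 1
    ext i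
    push_cast
    field_simp
    ring
  rw [key2]
  have hb : ∀ i ≤ m, i ≤ K → ‖((((K - i) * (m - i) / N - σ ^ 2 : ℝ) : ℂ) / σ * (z - 1) +
        σ * (z - 1 - Complex.I * ((s / σ : ℝ) : ℂ))) * w i‖ ≤
      (|s| / σ ^ 2 * ((2 * K + m) / N)) * i +
        (|s| / σ ^ 2 * |μ - σ ^ 2| + s ^ 2 / σ) * 1 := by
    intro i _ hiK
    rw [norm_mul, hwn, mul_one]
    refine (norm_add_le _ _).trans ?_
    rw [norm_mul, norm_mul, norm_div, Complex.norm_real, Complex.norm_real, Real.norm_eq_abs,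
      Real.norm_eq_abs, abs_of_pos hσ]
    have hiK' : (i : ℝ) ≤ K := by exact_mod_cast hiK
    have hi0 : (0 : ℝ) ≤ i := Nat.cast_nonneg i
    have h1 : |((K : ℝ) - i) * (m - i) / N - σ ^ 2| ≤ (2 * K + m) / N * i + |μ - σ ^ 2| := by
      have e : ((K : ℝ) - i) * (m - i) / N - σ ^ 2 =
          (-((K + m) * i) + i * i) / N + (μ - σ ^ 2) := by
        rw [hμ]; field_simp; ring
      rw [e]
      refine (abs_add_le _ _).trans (add_le_add_left ?_ _)
      rw [abs_div, abs_of_pos hNpos, div_mul_eq_mul_div]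
      gcongr
      rw [abs_le]
      have hm0 : (0 : ℝ) ≤ m := Nat.cast_nonneg m
      constructor <;> nlinarith [mul_nonneg hi0 hi0, mul_nonneg hm0 hi0,
        mul_le_mul_of_nonneg_left hiK' hi0]
    calc _ ≤ ((2 * K + m) / N * i + |μ - σ ^ 2|) / σ * (|s| / σ) + σ * (s ^ 2 / σ ^ 2) := by gcongr
      _ = _ := by field_simp; ring
  refine (norm_hyperMean_le hb).trans (le_of_eq ?_)
  rw [hyperMean_add, hyperMean_const_mul, hyperMean_const_mul, hyperMean_one h,
    hyperMean_id h h0, steinError, ← hN, ← hμ]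
  field_simp
  ring

/-- The Stein identity says that the characteristic function nearly solves `φ' = -s φ`, the equation
of the standard Gaussian one. -/
theorem norm_hyperChar_sub_le {K B m : ℕ} (h : m ≤ K + B) (h0 : 0 < K + B) {σ t : ℝ}
    (hσ : 0 < σ) (ht : |t| ≤ σ) :
    ‖Complex.exp ((t ^ 2 / 2 : ℝ) : ℂ) * hyperChar K B m σ t - 1‖ ≤
      Real.exp (t ^ 2 / 2) * (|t| * steinError K B m σ + t ^ 2 / σ) * |t| := by
  set c : ℕ → ℝ := fun i => (i - K * m / (K + B : ℕ)) / σ with hc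
  set ψ : ℝ → ℂ := fun s => hyperMean K B m (fun i => ((c i : ℝ) : ℂ) *
        Complex.exp (((s * c i : ℝ) : ℂ) * Complex.I)) with hψ
  have hφ : ∀ s, HasDerivAt (hyperChar K B m σ) (Complex.I * ψ s) s := by
    intro s
    have h1 : ∀ i : ℕ, HasDerivAt (fun s : ℝ => Complex.exp (((s * c i : ℝ) : ℂ) * Complex.I))
        (Complex.I * (((c i : ℝ) : ℂ) * Complex.exp (((s * c i : ℝ) : ℂ) * Complex.I))) s := by
      intro i
      have h2 : HasDerivAt (fun s : ℝ => ((s * c i : ℝ) : ℂ) * Complex.I)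
          (((1 * c i : ℝ) : ℂ) * Complex.I) s :=
        (((hasDerivAt_id s).mul_const (c i)).ofReal_comp).mul_const _
      have := h2.cexp
      convert this using 1
      push_cast
      ring
    have := hasDerivAt_hyperMean (K := K) (B := B) (m := m) h1
    rw [hyperMean_const_mul] at this
    exact this
  set F : ℝ → ℂ := fun s => Complex.exp ((s ^ 2 / 2 : ℝ) : ℂ) * hyperChar K B m σ s with hF
  have hFd : ∀ s, HasDerivAt F (Complex.exp ((s ^ 2 / 2 : ℝ) : ℂ) *
      (Complex.I * (ψ s - Complex.I * s * hyperChar K B m σ s))) s := by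
    intro s
    have h2 : HasDerivAt (fun s : ℝ => ((s ^ 2 / 2 : ℝ) : ℂ)) ((s : ℝ) : ℂ) s := by
      have : HasDerivAt (fun s : ℝ => s ^ 2 / 2) s s := by
        refine ((hasDerivAt_pow 2 s).div_const 2).congr_deriv ?_
        simp
      exact this.ofReal_comp
    refine (h2.cexp.mul (hφ s)).congr_deriv ?_
    linear_combination (Complex.exp ((s ^ 2 / 2 : ℝ) : ℂ) * s * hyperChar K B m σ s) *
      Complex.I_sq
  have hF0 : F 0 = 1 := by
    simp only [hF, hyperChar, zero_mul, Complex.ofReal_zero, Complex.exp_zero]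
    rw [hyperMean_one h]
    simp
  have hbound : ∀ s ∈ Set.uIcc 0 t, ‖Complex.exp ((s ^ 2 / 2 : ℝ) : ℂ) *
      (Complex.I * (ψ s - Complex.I * s * hyperChar K B m σ s))‖ ≤
      Real.exp (t ^ 2 / 2) * (|t| * steinError K B m σ + t ^ 2 / σ) := by
    intro s hs
    have hst : |s| ≤ |t| := by
      have := Set.abs_sub_left_of_mem_uIcc hs
      simpa using this
    have hsq : s ^ 2 ≤ t ^ 2 := sq_le_sq.2 hst
    have h1 := norm_hyperMean_stein_le h h0 hσ (hst.trans ht)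
    rw [norm_mul, norm_mul, Complex.norm_I, one_mul, Complex.norm_exp, Complex.ofReal_re]
    refine mul_le_mul (Real.exp_le_exp.2 (by linarith)) (h1.trans ?_) (norm_nonneg _)
      (Real.exp_pos _).le
    have := steinError_nonneg K B m σ
    gcongr
  have := (convex_uIcc (0 : ℝ) t).norm_image_sub_le_of_norm_hasDerivWithin_le
    (fun s _ => (hFd s).hasDerivWithinAt) hbound Set.left_mem_uIcc Set.right_mem_uIcc
  rw [hF0, sub_zero, Real.norm_eq_abs] at this
  exact this

/-- The law of `x(Y)` for a hypergeometric variable `Y`. -/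
noncomputable def hyperLaw (K B m : ℕ) (x : ℕ → ℝ) : Measure ℝ :=
  ∑ p ∈ antidiagonal m,
    ENNReal.ofReal ((K.choose p.1 : ℝ) * B.choose p.2 / (K + B).choose m) • Measure.dirac (x p.1)

theorem hyperLaw_real {K B m : ℕ} (x : ℕ → ℝ) {A : Set ℝ} (hA : MeasurableSet A) :
    (hyperLaw K B m x).real A = hyperMean K B m (fun i => A.indicator (fun _ => 1) (x i)) := by
  rw [Measure.real, hyperLaw, Measure.finsetSum_apply, ENNReal.toReal_sum, hyperMean, sum_div]
  · refine Finset.sum_congr rfl fun p _ => ?_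
    rw [Measure.smul_apply, smul_eq_mul, Measure.dirac_apply' _ hA, ENNReal.toReal_mul,
      ENNReal.toReal_ofReal (by positivity)]
    by_cases hx : x p.1 ∈ A <;> simp [hx]
  · intro p _
    rw [Measure.smul_apply, smul_eq_mul]
    exact ENNReal.mul_ne_top ENNReal.ofReal_ne_top (measure_ne_top _ _)

theorem isProbabilityMeasure_hyperLaw {K B m : ℕ} (h : m ≤ K + B) (x : ℕ → ℝ) :
    IsProbabilityMeasure (hyperLaw K B m x) := by
  have h1 := hyperLaw_real (K := K) (B := B) (m := m) x MeasurableSet.univ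
  simp only [Set.indicator_univ, hyperMean_one h] at h1
  refine ⟨?_⟩
  rw [← ENNReal.toReal_eq_one_iff]
  exact h1

theorem charFun_hyperLaw (K B m : ℕ) (x : ℕ → ℝ) (t : ℝ) :
    charFun (hyperLaw K B m x) t =
      hyperMean K B m (fun i => Complex.exp (((t * x i : ℝ) : ℂ) * Complex.I)) := by
  rw [charFun_apply_real, hyperLaw, integral_finsetSum_measure, hyperMean, sum_div]
  · refine Finset.sum_congr rfl fun p _ => ?_
    rw [integral_smul_measure, integral_dirac, ENNReal.toReal_ofReal (by positivity),
      Complex.real_smul]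
    push_cast
    ring
  · intro p _
    exact (integrable_dirac (by simp)).smul_measure ENNReal.ofReal_ne_top

theorem gaussianReal_neg_Iic_zero (x : ℝ) :
    (gaussianReal (-x) 1).real (Set.Iic 0) = stdGaussianCDF x := by
  rw [stdGaussianCDF, cdf_eq_real]
  have h := gaussianReal_map_add_const (μ := 0) (v := 1) (-x)
  rw [zero_add] at h
  rw [← h, map_measureReal_apply (by fun_prop) measurableSet_Iic]
  congr 1
  ext y
  simp

theorem continuous_stdGaussianCDF : Continuous stdGaussianCDF := by
  rw [continuous_iff_continuousAt]
  intro x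
  have hn : (1 : NNReal) ≠ 0 := one_ne_zero
  have : NullSingletonClass (gaussianReal 0 1) := nullSingletonClass_gaussianReal hn
  refine (Monotone.continuousAt_iff_leftLim_eq_rightLim (monotone_cdf _)).2 ?_
  have h1 : (cdf (gaussianReal 0 1)).measure {x} = 0 := by
    rw [measure_cdf]; exact measure_singleton x
  rw [StieltjesFunction.measure_singleton, ENNReal.ofReal_eq_zero] at h1
  rw [StieltjesFunction.rightLim_eq]
  exact le_antisymm ((monotone_cdf _).leftLim_le le_rfl) (by linarith)

/-- Central limit theorem for hypergeometric variables whose mean is asymptotically equal to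
`σ ^ 2`, with moving thresholds. -/
theorem tendsto_hyperMean_le {K B m : ℕ → ℕ} {σ c : ℕ → ℝ} {x : ℝ}
    (h : ∀ᶠ n in atTop, m n ≤ K n + B n) (hσ : Tendsto σ atTop atTop)
    (hη : Tendsto (fun n => steinError (K n) (B n) (m n) (σ n)) atTop (𝓝 0))
    (hc : Tendsto (fun n => (c n - K n * m n / (K n + B n : ℕ)) / σ n) atTop (𝓝 x)) :
    Tendsto (fun n => hyperMean (K n) (B n) (m n) (fun i => if (i : ℝ) ≤ c n then (1 : ℝ) else 0))
      atTop (𝓝 (stdGaussianCDF x)) := by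
  -- Where `K n + B n = 0`, the mean vanishes and `steinError` is `1`.
  have hpos : ∀ᶠ n in atTop, 0 < K n + B n := by
    filter_upwards [hη.eventually (gt_mem_nhds one_pos), hσ.eventually_gt_atTop 0] with n h1 h2
    by_contra h3
    have h4 : K n + B n = 0 := by omega
    rw [steinError, h4] at h1
    have : |(K n : ℝ) * m n / (0 : ℕ) - σ n ^ 2| = σ n ^ 2 := by simp
    rw [this] at h1
    simp [h2.ne'] at h1
  obtain ⟨n₀, hn₀⟩ := eventually_atTop.1 (h.and (hpos.and (hσ.eventually_gt_atTop 0)))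
  rw [← tendsto_add_atTop_iff_nat n₀]
  replace hσ := (tendsto_add_atTop_iff_nat n₀).2 hσ
  replace hη := (tendsto_add_atTop_iff_nat n₀).2 hη
  replace hc := (tendsto_add_atTop_iff_nat n₀).2 hc
  set K' := fun n => K (n + n₀) with hK'
  set B' := fun n => B (n + n₀)
  set m' := fun n => m (n + n₀)
  set σ' := fun n => σ (n + n₀)
  set c' := fun n => c (n + n₀)
  have hm' : ∀ n, m' n ≤ K' n + B' n := fun n => (hn₀ (n + n₀) (by omega)).1
  have hN' : ∀ n, 0 < K' n + B' n := fun n => (hn₀ (n + n₀) (by omega)).2.1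
  have hs' : ∀ n, 0 < σ' n := fun n => (hn₀ (n + n₀) (by omega)).2.2
  change Tendsto (fun n => hyperMean (K' n) (B' n) (m' n)
    (fun i => if (i : ℝ) ≤ c' n then (1 : ℝ) else 0)) atTop _
  change Tendsto (fun n => (c' n - K' n * m' n / (K' n + B' n : ℕ)) / σ' n) atTop _ at hc
  change Tendsto (fun n => steinError (K' n) (B' n) (m' n) (σ' n)) atTop _ at hη
  change Tendsto σ' atTop atTop at hσ
  set μs : ℕ → ProbabilityMeasure ℝ := fun n =>
    ⟨hyperLaw (K' n) (B' n) (m' n) (fun i => (i - c' n) / σ' n),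
      isProbabilityMeasure_hyperLaw (hm' n) _⟩ with hμs
  set μ₀ : ProbabilityMeasure ℝ := ⟨gaussianReal (-x) 1, inferInstance⟩ with hμ₀
  have hlim : Tendsto μs atTop (𝓝 μ₀) := by
    refine ProbabilityMeasure.tendsto_of_tendsto_charFun fun t => ?_
    have hφ : Tendsto (fun n => Complex.exp ((t ^ 2 / 2 : ℝ) : ℂ) *
        hyperChar (K' n) (B' n) (m' n) (σ' n) t) atTop (𝓝 1) := by
      rw [tendsto_iff_norm_sub_tendsto_zero]
      have hb : Tendsto (fun n => Real.exp (t ^ 2 / 2) *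
          (|t| * steinError (K' n) (B' n) (m' n) (σ' n) + t ^ 2 / σ' n) * |t|) atTop (𝓝 0) := by
        have := (((hη.const_mul |t|).add (hσ.const_div_atTop (t ^ 2))).const_mul
          (Real.exp (t ^ 2 / 2))).mul_const |t|
        simpa using this
      refine squeeze_zero' (Eventually.of_forall fun n => norm_nonneg _) ?_ hb
      filter_upwards [hσ.eventually_ge_atTop |t|] with n hn
      exact norm_hyperChar_sub_le (hm' n) (hN' n) (hs' n) hn
    have hexp : Tendsto (fun n => Complex.exp
        (((-(t * ((c' n - K' n * m' n / (K' n + B' n : ℕ)) / σ' n)) : ℝ) : ℂ) * Complex.I)) atTop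
        (𝓝 (Complex.exp (((-(t * x) : ℝ) : ℂ) * Complex.I))) := by
      have h1 : Continuous fun y : ℝ => Complex.exp (((-(t * y) : ℝ) : ℂ) * Complex.I) := by
        fun_prop
      exact (h1.tendsto x).comp hc
    have hfin := (hφ.mul hexp).const_mul (Complex.exp (-((t ^ 2 / 2 : ℝ) : ℂ)))
    have e0 : Complex.exp (-((t ^ 2 / 2 : ℝ) : ℂ)) *
        (1 * Complex.exp (((-(t * x) : ℝ) : ℂ) * Complex.I)) = charFun (μ₀ : Measure ℝ) t := by
      rw [hμ₀, ProbabilityMeasure.coe_mk, charFun_gaussianReal, one_mul, ← Complex.exp_add]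
      congr 1
      push_cast
      ring
    rw [e0] at hfin
    refine hfin.congr fun n => ?_
    rw [hμs, ProbabilityMeasure.coe_mk, charFun_hyperLaw, mul_assoc, ← mul_assoc (Complex.exp _),
      ← Complex.exp_add, neg_add_cancel, Complex.exp_zero, one_mul, mul_comm, hyperChar,
      ← hyperMean_const_mul]
    congr 1
    ext i
    rw [← Complex.exp_add]
    congr 1
    rw [← add_mul, ← Complex.ofReal_add]
    congr 2
    ring
  have hfr : (μ₀ : Measure ℝ) (frontier (Set.Iic 0)) = 0 := by
    have : NullSingletonClass (gaussianReal (-x) 1) := nullSingletonClass_gaussianReal one_ne_zero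
    rw [frontier_Iic]
    exact measure_singleton (μ := gaussianReal (-x) 1) 0
  have := ProbabilityMeasure.tendsto_measure_of_null_frontier_of_tendsto' hlim hfr
  have h2 := (ENNReal.tendsto_toReal (measure_ne_top _ _)).comp this
  rw [show ((μ₀ : Measure ℝ) (Set.Iic 0)).toReal = stdGaussianCDF x from
    gaussianReal_neg_Iic_zero x] at h2
  refine h2.congr fun n => ?_
  have h3 := hyperLaw_real (K := K' n) (B := B' n) (m := m' n) (fun i => (i - c' n) / σ' n)
    (measurableSet_Iic (a := (0 : ℝ)))
  refine Eq.trans h3 ?_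
  congr 1
  ext i
  rw [Set.indicator_apply]
  have : (i - c' n) / σ' n ∈ Set.Iic (0 : ℝ) ↔ (i : ℝ) ≤ c' n := by
    rw [Set.mem_Iic, div_nonpos_iff]
    constructor
    · rintro (h | h)
      · linarith [hs' n, h.2]
      · linarith [h.1]
    · intro h
      exact Or.inr ⟨by linarith, (hs' n).le⟩
  simp only [this]

end CLT

/-! ### Estimates for the likelihood ratio of a single hub -/

/-- The likelihood ratio as a product over the `k` planted edges, to be compared with the product of
the factors `(T - i) / d`. -/
theorem starRatio_eq_prod {K B m k T : ℕ} (hK : k ≤ K) (hm : k ≤ m) (h : m ≤ K + B) (hT : k ≤ T) :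
    starRatio K B m k T =
      ∏ i ∈ range k, ((T : ℝ) - i) * (((K + B : ℕ) : ℝ) - i) / (((K : ℝ) - i) * ((m : ℝ) - i)) := by
  have hprod : ∀ a : ℕ, k ≤ a → (a.choose k : ℝ) * k.factorial = ∏ i ∈ range k, ((a : ℝ) - i) := by
    intro a ha
    have h1 : a.choose k * k.factorial = ∏ i ∈ range k, (a - i) := by
      rw [mul_comm, ← Nat.descFactorial_eq_factorial_mul_choose, Nat.descFactorial_eq_prod_range]
    have h2 : ((a.choose k * k.factorial : ℕ) : ℝ) = ((∏ i ∈ range k, (a - i) : ℕ) : ℝ) := by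
      rw [h1]
    push_cast at h2
    rw [h2]
    refine prod_congr rfl fun i hi => ?_
    rw [Nat.cast_sub (by have := mem_range.1 hi; omega)]
  have hf : (k.factorial : ℝ) ≠ 0 := by exact_mod_cast k.factorial_ne_zero
  have h1 : ((K + B).choose m : ℝ) ≠ 0 := choose_add_ne_zero h
  have h2 : (K.choose k : ℝ) ≠ 0 := by exact_mod_cast (Nat.choose_pos hK).ne'
  have h3 : (m.choose k : ℝ) ≠ 0 := by exact_mod_cast (Nat.choose_pos hm).ne'
  have h4 : ((K + B - k).choose (m - k) : ℝ) ≠ 0 := by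
    exact_mod_cast (Nat.choose_pos (by omega)).ne'
  have h5 : ((K + B).choose m : ℝ) * m.choose k =
      (K + B).choose k * (K + B - k).choose (m - k) := by
    exact_mod_cast Nat.choose_mul (n := K + B) hm
  rw [prod_div_distrib, prod_mul_distrib, prod_mul_distrib, ← hprod T hT, ← hprod _ (by omega),
    ← hprod K hK, ← hprod m hm, starRatio, starWeight]
  field_simp
  linear_combination (T.choose k : ℝ) * h5

theorem sum_range_cast_id (k : ℕ) : ∑ i ∈ range k, (i : ℝ) = k * (k - 1) / 2 := by
  induction k with
  | zero => simp
  | succ k ih => rw [sum_range_succ, ih]; push_cast; ring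

section Ratio
variable {K B m k T : ℕ} {d : ℝ}

theorem starRatio_le_exp (hK : 2 * k ≤ K) (hm : 2 * k ≤ m) (h : m ≤ K + B) (hT : k ≤ T)
    (hd : d = K * m / (K + B : ℕ)) (hd0 : 0 < d) :
    starRatio K B m k T ≤ Real.exp (k * (T - d) / d - (k : ℝ) ^ 2 / (2 * d) + k / (2 * d) +
      2 * (k : ℝ) ^ 2 / K + 2 * (k : ℝ) ^ 2 / m) := by
  have hNpos : (0 : ℝ) < (K + B : ℕ) := by
    rcases Nat.eq_zero_or_pos (K + B) with h0 | h0
    · rw [h0] at hd; simp [hd] at hd0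
    · exact_mod_cast h0
  have hKm : (0 : ℝ) < K * m := by
    rw [hd, lt_div_iff₀ hNpos, zero_mul] at hd0; exact hd0
  have hKpos : (0 : ℝ) < K := pos_of_mul_pos_left hKm (Nat.cast_nonneg _)
  have hmpos : (0 : ℝ) < m := pos_of_mul_pos_right hKm (Nat.cast_nonneg _)
  have inv_le : ∀ a i : ℝ, 0 < a → 0 ≤ i → 2 * i ≤ a → a / (a - i) ≤ Real.exp (2 * i / a) := by
    intro a i ha hi hia
    have h1 := Real.add_one_le_exp (2 * i / a)
    refine le_trans ?_ h1
    rw [div_add_one ha.ne', div_le_div_iff₀ (by linarith) ha]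
    nlinarith
  have key : ∀ i ∈ range k, ((T : ℝ) - i) * (((K + B : ℕ) : ℝ) - i) /
      (((K : ℝ) - i) * ((m : ℝ) - i)) ≤
      Real.exp ((T - d) / d - i / d + (2 * k / K + 2 * k / m)) := by
    intro i hi
    have hik : (i : ℝ) < k := by exact_mod_cast mem_range.1 hi
    have hi0 : (0 : ℝ) ≤ i := Nat.cast_nonneg i
    have hKR : 2 * (k : ℝ) ≤ K := by exact_mod_cast hK
    have hmR : 2 * (k : ℝ) ≤ m := by exact_mod_cast hm
    have hTR : (k : ℝ) ≤ T := by exact_mod_cast hT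
    have e : ((T : ℝ) - i) * (((K + B : ℕ) : ℝ) - i) / (((K : ℝ) - i) * ((m : ℝ) - i)) =
        ((T - i) / d) * (((K + B : ℕ) - i) / (K + B : ℕ)) * ((K / (K - i)) * (m / (m - i))) := by
      have : (K : ℝ) - i ≠ 0 := by linarith
      have : (m : ℝ) - i ≠ 0 := by linarith
      rw [hd]
      field_simp
    rw [e]
    have h1 : (T - i) / d ≤ Real.exp ((T - d) / d - i / d) := by
      refine le_trans (le_of_eq ?_) (Real.add_one_le_exp _)
      field_simp
      ring
    have h2 : (((K + B : ℕ) : ℝ) - i) / (K + B : ℕ) ≤ 1 := by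
      rw [div_le_one hNpos]; linarith
    have h3 : (K : ℝ) / (K - i) * (m / (m - i)) ≤ Real.exp (2 * k / K + 2 * k / m) := by
      rw [Real.exp_add]
      refine mul_le_mul ((inv_le K i hKpos hi0 (by linarith)).trans ?_)
        ((inv_le m i hmpos hi0 (by linarith)).trans ?_)
        (div_nonneg hmpos.le (by linarith)) (Real.exp_pos _).le <;> gcongr
    have h4 : 0 ≤ ((T : ℝ) - i) / d := div_nonneg (by linarith) hd0.le
    rw [Real.exp_add]
    refine mul_le_mul ((mul_le_of_le_one_right h4 h2).trans h1) h3 ?_ (Real.exp_pos _).le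
    exact mul_nonneg (div_nonneg hKpos.le (by linarith)) (div_nonneg hmpos.le (by linarith))
  rw [starRatio_eq_prod (by omega) (by omega) h hT]
  refine (prod_le_prod (fun i hi => ?_) key).trans (le_of_eq ?_)
  · have hik : (i : ℝ) < k := by exact_mod_cast mem_range.1 hi
    have hKR : 2 * (k : ℝ) ≤ K := by exact_mod_cast hK
    have hmR : 2 * (k : ℝ) ≤ m := by exact_mod_cast hm
    have hTR : (k : ℝ) ≤ T := by exact_mod_cast hT
    have hNR : (m : ℝ) ≤ (K + B : ℕ) := by exact_mod_cast h
    have hi0 : (0 : ℝ) ≤ i := Nat.cast_nonneg i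
    exact div_nonneg (mul_nonneg (by linarith) (by linarith))
      (mul_nonneg (by linarith) (by linarith))
  · rw [← Real.exp_sum]
    congr 1
    rw [sum_add_distrib, sum_sub_distrib, sum_const, sum_const, ← sum_div, sum_range_cast_id,
      card_range, nsmul_eq_mul, nsmul_eq_mul]
    field_simp
    ring

theorem exp_sub_two_sq_le {x : ℝ} (hx : -(1 / 2) ≤ x) : Real.exp (x - 2 * x ^ 2) ≤ 1 + x := by
  have h1 := Real.add_one_le_exp (-(x - 2 * x ^ 2))
  have h2 : 0 < -(x - 2 * x ^ 2) + 1 := by nlinarith [sq_nonneg (x - 1 / 4)]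
  rw [← inv_inv (Real.exp (x - 2 * x ^ 2)), ← Real.exp_neg]
  refine (inv_anti₀ h2 h1).trans ?_
  rw [inv_le_iff_one_le_mul₀ h2]
  nlinarith [mul_nonneg (sq_nonneg x) (show 0 ≤ 1 + 2 * x by linarith)]

theorem exp_le_starRatio (hK : k ≤ K) (hm : k ≤ m) (h : m ≤ K + B) (hT : k ≤ T)
    (hd : d = K * m / (K + B : ℕ)) (hd0 : 0 < d) (hx : (|(T : ℝ) - d| + k) / d ≤ 1 / 2) :
    Real.exp (k * (T - d) / d - (k : ℝ) ^ 2 / (2 * d) - 2 * (k * ((|(T : ℝ) - d| + k) / d) ^ 2)) ≤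
      starRatio K B m k T := by
  have hNpos : (0 : ℝ) < (K + B : ℕ) := by
    rcases Nat.eq_zero_or_pos (K + B) with h0 | h0
    · rw [h0] at hd; simp [hd] at hd0
    · exact_mod_cast h0
  set y := (|(T : ℝ) - d| + k) / d with hy
  have key : ∀ i ∈ range k, Real.exp ((T - d) / d - i / d - 2 * y ^ 2) ≤
      ((T : ℝ) - i) * (((K + B : ℕ) : ℝ) - i) / (((K : ℝ) - i) * ((m : ℝ) - i)) := by
    intro i hi
    have hik : (i : ℝ) < k := by exact_mod_cast mem_range.1 hi
    have hi0 : (0 : ℝ) ≤ i := Nat.cast_nonneg i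
    have hKR : (k : ℝ) ≤ K := by exact_mod_cast hK
    have hmR : (k : ℝ) ≤ m := by exact_mod_cast hm
    have hTR : (k : ℝ) ≤ T := by exact_mod_cast hT
    have hNR : (m : ℝ) ≤ (K + B : ℕ) := by exact_mod_cast h
    have hxy : |((T : ℝ) - d) / d - i / d| ≤ y := by
      rw [← sub_div, abs_div, abs_of_pos hd0, hy]
      gcongr
      refine (abs_sub _ _).trans ?_
      rw [abs_of_nonneg hi0]
      linarith
    have h1 : Real.exp ((T - d) / d - i / d - 2 * y ^ 2) ≤ (T - i) / d := by
      have h2 := exp_sub_two_sq_le (x := ((T : ℝ) - d) / d - i / d)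
        (by linarith [(abs_le.1 hxy).1])
      have h3 : (((T : ℝ) - d) / d - i / d) ^ 2 ≤ y ^ 2 :=
        sq_le_sq.2 (hxy.trans (le_abs_self y))
      refine (Real.exp_le_exp.2 (by linarith)).trans (h2.trans (le_of_eq ?_))
      field_simp
      ring
    refine h1.trans ?_
    have hKi : 0 < (K : ℝ) - i := by linarith
    have hmi : 0 < (m : ℝ) - i := by linarith
    have hTi : 0 < (T : ℝ) - i := by linarith
    rw [div_le_div_iff₀ hd0 (by positivity), hd, mul_div_assoc', le_div_iff₀ hNpos]
    have h4 : ((K : ℝ) - i) * (((m : ℝ) - i) * (K + B : ℕ)) ≤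
        K * (m * (((K + B : ℕ) : ℝ) - i)) := by
      refine mul_le_mul (by linarith) (by nlinarith) (by positivity) (by linarith)
    nlinarith [mul_le_mul_of_nonneg_left h4 hTi.le]
  rw [starRatio_eq_prod hK hm h hT]
  refine le_trans ?_ (prod_le_prod (fun i _ => (Real.exp_pos _).le) key)
  rw [← Real.exp_sum, Real.exp_le_exp, sum_sub_distrib, sum_sub_distrib, sum_const, sum_const,
    ← sum_div, sum_range_cast_id, card_range, nsmul_eq_mul, nsmul_eq_mul]
  have h1 : (k : ℝ) * ((T - d) / d) - k * (k - 1) / 2 / d - k * (2 * y ^ 2) =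
      k * (T - d) / d - (k : ℝ) ^ 2 / (2 * d) - 2 * (k * y ^ 2) + k / (2 * d) := by
    field_simp
    ring
  rw [h1]
  exact le_add_of_nonneg_right (by positivity)

end Ratio

/-! ### Asymptotics at the critical scaling -/

/-- The asymptotic assumptions on `k` and `m`. -/
structure CriticalScaling (γ : ℝ) (k m : ℕ → ℕ) : Prop where
  lower : (fun n : ℕ => Real.log n ^ 2) =o[atTop] (fun n : ℕ => (k n : ℝ))
  upper : (fun n : ℕ => (k n : ℝ)) =o[atTop] (fun n : ℕ => √(n : ℝ))
  edges : ∀ᶠ n : ℕ in atTop,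
    |(m n : ℝ) - (k n : ℝ) ^ 2 * n / (4 * Real.log n) * (1 + γ / √(Real.log n))| < 1

/-- The average degree of a graph with `n` vertices and `m n` edges. -/
noncomputable def avgDeg (m : ℕ → ℕ) (n : ℕ) : ℝ := 2 * m n / n

/-- The average degree relative to its leading order `k ^ 2 / (2 log n)`. -/
noncomputable def relDeg (k m : ℕ → ℕ) (n : ℕ) : ℝ :=
  avgDeg m n * (2 * Real.log n) / (k n : ℝ) ^ 2

theorem tendsto_log_natCast : Tendsto (fun n : ℕ => Real.log n) atTop atTop :=
  Real.tendsto_log_atTop.comp tendsto_natCast_atTop_atTop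

theorem tendsto_sqrt_log : Tendsto (fun n : ℕ => √(Real.log n)) atTop atTop :=
  Real.tendsto_sqrt_atTop.comp tendsto_log_natCast

theorem tendsto_log_div : Tendsto (fun n : ℕ => Real.log n / n) atTop (𝓝 0) :=
  (Real.isLittleO_log_id_atTop.comp_tendsto tendsto_natCast_atTop_atTop).tendsto_div_nhds_zero

theorem half_le_cast_pred {n : ℕ} (hn : 2 ≤ n) : (n : ℝ) / 2 ≤ (n - 1 : ℕ) := by
  rw [Nat.cast_sub (by omega), Nat.cast_one]
  have : (2 : ℝ) ≤ n := by exact_mod_cast hn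
  linarith

theorem cast_choose_two_eq {n : ℕ} (hn : 2 ≤ n) :
    ((n.choose 2 : ℕ) : ℝ) = (n - 1 : ℕ) * n / 2 := by
  rw [Nat.cast_choose_two, Nat.cast_sub (by omega), Nat.cast_one]
  ring

theorem avgDeg_eq (m : ℕ → ℕ) {n : ℕ} (hn : 2 ≤ n) :
    avgDeg m n = (n - 1 : ℕ) * m n / (n.choose 2 : ℕ) := by
  have h1 : ((n - 1 : ℕ) : ℝ) ≠ 0 := by exact_mod_cast (show n - 1 ≠ 0 by omega)
  have h2 : (n : ℝ) ≠ 0 := by exact_mod_cast (show n ≠ 0 by omega)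
  rw [avgDeg, cast_choose_two_eq hn]
  field_simp

theorem density_eq (m : ℕ → ℕ) {n : ℕ} (hn : 2 ≤ n) :
    (m n : ℝ) / (n.choose 2 : ℕ) = avgDeg m n / (n - 1 : ℕ) := by
  have h1 : ((n - 1 : ℕ) : ℝ) ≠ 0 := by exact_mod_cast (show n - 1 ≠ 0 by omega)
  rw [avgDeg_eq m hn]
  field_simp

namespace CriticalScaling
variable {γ : ℝ} {k m : ℕ → ℕ}

theorem tendsto_log_sq_div (hs : CriticalScaling γ k m) :
    Tendsto (fun n : ℕ => Real.log n ^ 2 / k n) atTop (𝓝 0) :=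
  hs.lower.tendsto_div_nhds_zero

theorem eventually_log_sq_le (hs : CriticalScaling γ k m) :
    ∀ᶠ n : ℕ in atTop, Real.log n ^ 2 ≤ k n := by
  filter_upwards [hs.lower.bound one_pos] with n hn
  simpa using hn

theorem tendsto_k (hs : CriticalScaling γ k m) :
    Tendsto (fun n : ℕ => (k n : ℝ)) atTop atTop :=
  tendsto_atTop_mono' _ hs.eventually_log_sq_le
    ((tendsto_pow_atTop two_ne_zero).comp tendsto_log_natCast)

theorem tendsto_sq_div (hs : CriticalScaling γ k m) :
    Tendsto (fun n : ℕ => (k n : ℝ) ^ 2 / n) atTop (𝓝 0) := by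
  have := hs.upper.tendsto_div_nhds_zero.pow 2
  simpa [div_pow] using this

/-- The rounding of `m` to an integer is invisible at the scale `1 / √(log n)`. -/
theorem tendsto_relDeg_sub_one_mul (hs : CriticalScaling γ k m) :
    Tendsto (fun n : ℕ => (relDeg k m n - 1) * √(Real.log n)) atTop (𝓝 γ) := by
  rw [tendsto_iff_norm_sub_tendsto_zero]
  refine squeeze_zero' (Eventually.of_forall fun n => norm_nonneg _) ?_
    (tendsto_const_div_atTop_nhds_zero_nat (4 : ℝ))
  filter_upwards [hs.edges, hs.eventually_log_sq_le, tendsto_log_natCast.eventually_ge_atTop 1,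
    hs.tendsto_k.eventually_ge_atTop 1, eventually_ge_atTop 1] with n h1 h2 h3 h4 h5
  have hn : (0 : ℝ) < n := by exact_mod_cast h5
  set l := Real.log n with hl
  have hl0 : 0 < l := by linarith
  have hsl : 0 < √l := Real.sqrt_pos.2 hl0
  have hss : √l * √l = l := Real.mul_self_sqrt hl0.le
  set δ := (m n : ℝ) - (k n : ℝ) ^ 2 * n / (4 * l) * (1 + γ / √l) with hδ
  have e : (relDeg k m n - 1) * √l - γ = √l * (4 * l / (n * (k n : ℝ) ^ 2)) * δ := by
    rw [relDeg, avgDeg, ← hl, hδ]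
    have : (k n : ℝ) ≠ 0 := by linarith
    field_simp
    ring
  have hsl1 : √l ≤ l := by
    have : (1 : ℝ) ≤ √l := Real.one_le_sqrt.2 h3
    nlinarith
  rw [Real.norm_eq_abs, e, abs_mul, abs_of_nonneg (by positivity)]
  calc √l * (4 * l / (n * (k n : ℝ) ^ 2)) * |δ| ≤ √l * (4 * l / (n * (k n : ℝ) ^ 2)) * 1 := by
        gcongr
    _ ≤ 4 / (n : ℝ) := by
        rw [mul_one, mul_div_assoc', div_le_div_iff₀ (by positivity) hn]
        have h6 : √l * l ≤ (k n : ℝ) ^ 2 := by nlinarith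
        nlinarith [mul_le_mul_of_nonneg_left h6 hn.le]

theorem tendsto_relDeg (hs : CriticalScaling γ k m) :
    Tendsto (fun n : ℕ => relDeg k m n) atTop (𝓝 1) := by
  have h1 := (hs.tendsto_relDeg_sub_one_mul.div_atTop tendsto_sqrt_log).add_const 1
  rw [zero_add] at h1
  refine h1.congr' ?_
  filter_upwards [tendsto_sqrt_log.eventually_gt_atTop 0] with n hn
  rw [mul_div_cancel_right₀ _ hn.ne', sub_add_cancel]

/-- Positivity of all quantities in play, for large `n`. -/
theorem eventually_pos (hs : CriticalScaling γ k m) :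
    ∀ᶠ n : ℕ in atTop, 2 ≤ n ∧ 1 ≤ Real.log n ∧ (1 : ℝ) ≤ k n ∧ 0 < relDeg k m n ∧
      0 < avgDeg m n ∧ avgDeg m n = relDeg k m n * (k n : ℝ) ^ 2 / (2 * Real.log n) := by
  filter_upwards [eventually_ge_atTop 2, tendsto_log_natCast.eventually_ge_atTop 1,
    hs.tendsto_k.eventually_ge_atTop 1, hs.tendsto_relDeg.eventually (lt_mem_nhds one_pos)]
    with n h1 h2 h3 h4
  have e : avgDeg m n = relDeg k m n * (k n : ℝ) ^ 2 / (2 * Real.log n) := by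
    have : (k n : ℝ) ≠ 0 := by linarith
    have : Real.log n ≠ 0 := by linarith
    rw [relDeg]
    field_simp
  refine ⟨h1, h2, h3, h4, ?_, e⟩
  rw [e]
  positivity

/-- Planting the star shifts the hub degree by `√(2 log n) - γ / √2` standard deviations. -/
theorem tendsto_shift (hs : CriticalScaling γ k m) :
    Tendsto (fun n : ℕ => k n / √(avgDeg m n) - √(2 * Real.log n)) atTop (𝓝 (-(γ / √2))) := by
  have hr := hs.tendsto_relDeg.sqrt
  rw [Real.sqrt_one] at hr
  have h1 := (hs.tendsto_relDeg_sub_one_mul.const_mul (-√2)).div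
    (hr.mul (hr.const_add 1)) (by norm_num)
  have e : -√2 * γ / (1 * (1 + 1)) = -(γ / √2) := by
    have : √2 * √2 = 2 := Real.mul_self_sqrt (by norm_num)
    have h0 : √2 ≠ 0 := by positivity
    field_simp
    linear_combination (-γ) * this
  rw [e] at h1
  refine h1.congr' ?_
  filter_upwards [hs.eventually_pos] with n ⟨_, h2, h3, h4, h5, h6⟩
  set l := Real.log n
  set r := relDeg k m n
  have hl : 0 < l := by linarith
  have hk : (0 : ℝ) < k n := by linarith
  have hr0 : 0 < √r := Real.sqrt_pos.2 h4
  have hrr : √r * √r = r := Real.mul_self_sqrt h4.le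
  have hd : √(avgDeg m n) = √r * k n / √(2 * l) := by
    rw [h6, Real.sqrt_div (by positivity), Real.sqrt_mul h4.le, Real.sqrt_sq hk.le]
  have hb : √(2 * l) = √2 * √l := Real.sqrt_mul (by norm_num) l
  have hl0 : 0 < √l := Real.sqrt_pos.2 hl
  have h20 : 0 < √2 := by positivity
  change -√2 * ((r - 1) * √l) / (√r * (1 + √r)) = k n / √(avgDeg m n) - √(2 * l)
  rw [hd, hb]
  have : 1 + √r ≠ 0 := by positivity
  field_simp
  linear_combination hrr

theorem tendsto_log_mul_div (hs : CriticalScaling γ k m) :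
    Tendsto (fun n : ℕ => Real.log n * (k n / avgDeg m n)) atTop (𝓝 0) := by
  have h1 := (hs.tendsto_log_sq_div.const_mul 2).div hs.tendsto_relDeg one_ne_zero
  rw [mul_zero, zero_div] at h1
  refine h1.congr' ?_
  filter_upwards [hs.eventually_pos] with n ⟨_, h2, h3, h4, h5, h6⟩
  have : Real.log n ≠ 0 := by linarith
  have : (k n : ℝ) ≠ 0 := by linarith
  simp only [Pi.div_apply]
  rw [h6]
  field_simp

theorem tendsto_div_avgDeg (hs : CriticalScaling γ k m) :
    Tendsto (fun n : ℕ => k n / avgDeg m n) atTop (𝓝 0) := by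
  refine squeeze_zero' ?_ ?_ hs.tendsto_log_mul_div
  · filter_upwards [hs.eventually_pos] with n ⟨_, h2, h3, h4, h5, h6⟩
    positivity
  · filter_upwards [hs.eventually_pos] with n ⟨_, h2, h3, h4, h5, h6⟩
    exact le_mul_of_one_le_left (by positivity) h2

theorem tendsto_avgDeg (hs : CriticalScaling γ k m) : Tendsto (avgDeg m) atTop atTop := by
  have h1 : Tendsto (fun n : ℕ => (avgDeg m n)⁻¹) atTop (𝓝[>] 0) := by
    refine tendsto_nhdsWithin_iff.2 ⟨?_, ?_⟩
    · refine squeeze_zero' ?_ ?_ hs.tendsto_div_avgDeg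
      · filter_upwards [hs.eventually_pos] with n ⟨_, h2, h3, h4, h5, h6⟩
        positivity
      · filter_upwards [hs.eventually_pos] with n ⟨_, h2, h3, h4, h5, h6⟩
        rw [div_eq_mul_inv]
        exact le_mul_of_one_le_left (by positivity) h3
    · filter_upwards [hs.eventually_pos] with n ⟨_, h2, h3, h4, h5, h6⟩
      exact inv_pos.2 h5
  simpa [Function.comp_def] using tendsto_inv_nhdsGT_zero.comp h1

theorem tendsto_log_mul_avgDeg_div (hs : CriticalScaling γ k m) :
    Tendsto (fun n : ℕ => Real.log n * (avgDeg m n / n)) atTop (𝓝 0) := by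
  have h1 := (hs.tendsto_relDeg.mul hs.tendsto_sq_div).div_const 2
  rw [mul_zero, zero_div] at h1
  refine h1.congr' ?_
  filter_upwards [hs.eventually_pos] with n ⟨_, h2, h3, h4, h5, h6⟩
  have : Real.log n ≠ 0 := by linarith
  rw [h6]
  field_simp

/-- The edge density is negligible, even after multiplication by `log n`. -/
theorem tendsto_log_mul_density (hs : CriticalScaling γ k m) :
    Tendsto (fun n : ℕ => Real.log n * ((m n : ℝ) / (n.choose 2 : ℕ))) atTop (𝓝 0) := by
  have h1 := hs.tendsto_log_mul_avgDeg_div.const_mul 2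
  rw [mul_zero] at h1
  refine squeeze_zero' ?_ ?_ h1
  · filter_upwards [hs.eventually_pos] with n ⟨_, h2, h3, h4, h5, h6⟩
    positivity
  · filter_upwards [hs.eventually_pos] with n ⟨h0, h2, h3, h4, h5, h6⟩
    rw [density_eq m h0]
    have h7 := half_le_cast_pred h0
    have hn : (0 : ℝ) < n := by exact_mod_cast (show 0 < n by omega)
    calc Real.log n * (avgDeg m n / (n - 1 : ℕ)) ≤ Real.log n * (avgDeg m n / (n / 2)) := by gcongr
      _ = _ := by field_simp

theorem tendsto_density (hs : CriticalScaling γ k m) :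
    Tendsto (fun n : ℕ => (m n : ℝ) / (n.choose 2 : ℕ)) atTop (𝓝 0) := by
  refine squeeze_zero' (Eventually.of_forall fun n => by positivity) ?_ hs.tendsto_log_mul_density
  filter_upwards [hs.eventually_pos] with n ⟨_, h2, h3, h4, h5, h6⟩
  exact le_mul_of_one_le_left (by positivity) h2

theorem tendsto_sq_div_pred (hs : CriticalScaling γ k m) :
    Tendsto (fun n : ℕ => (k n : ℝ) ^ 2 / (n - 1 : ℕ)) atTop (𝓝 0) := by
  have h1 := hs.tendsto_sq_div.const_mul 2
  rw [mul_zero] at h1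
  refine squeeze_zero' (Eventually.of_forall fun n => by positivity) ?_ h1
  filter_upwards [eventually_ge_atTop 2] with n h0
  have h7 := half_le_cast_pred h0
  have hn : (0 : ℝ) < n := by exact_mod_cast (show 0 < n by omega)
  calc (k n : ℝ) ^ 2 / (n - 1 : ℕ) ≤ (k n : ℝ) ^ 2 / (n / 2) := by gcongr
    _ = _ := by field_simp

theorem tendsto_sq_div_edges (hs : CriticalScaling γ k m) :
    Tendsto (fun n : ℕ => (k n : ℝ) ^ 2 / m n) atTop (𝓝 0) := by
  have h1 := (hs.tendsto_sq_div.div_atTop hs.tendsto_avgDeg).const_mul 2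
  rw [mul_zero] at h1
  refine h1.congr' ?_
  filter_upwards [hs.eventually_pos] with n ⟨h0, h2, h3, h4, h5, h6⟩
  have hn : (n : ℝ) ≠ 0 := by exact_mod_cast (show n ≠ 0 by omega)
  rw [avgDeg] at h5 ⊢
  have hm : (m n : ℝ) ≠ 0 := by
    intro h; rw [h] at h5; simp at h5
  field_simp

/-- The sizes are admissible, with room to spare, for large `n`. -/
theorem eventually_admissible (hs : CriticalScaling γ k m) :
    ∀ᶠ n : ℕ in atTop, 2 * k n ≤ n - 1 ∧ 2 * k n ≤ m n ∧ m n < n.choose 2 ∧ 0 < k n := by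
  filter_upwards [hs.eventually_pos,
    hs.tendsto_sq_div_pred.eventually (gt_mem_nhds (show (0 : ℝ) < 1 / 2 by norm_num)),
    hs.tendsto_sq_div_edges.eventually (gt_mem_nhds (show (0 : ℝ) < 1 / 2 by norm_num)),
    hs.tendsto_density.eventually (gt_mem_nhds one_pos)]
    with n ⟨h0, h2, h3, h4, h5, h6⟩ h7 h8 h9
  have hK : (0 : ℝ) < (n - 1 : ℕ) := by exact_mod_cast (show 0 < n - 1 by omega)
  have hm : (0 : ℝ) < m n := by
    rw [avgDeg] at h5
    rcases (Nat.cast_nonneg (α := ℝ) (m n)).eq_or_lt with h | h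
    · rw [← h] at h5; simp at h5
    · exact h
  have hN : (0 : ℝ) < (n.choose 2 : ℕ) := by exact_mod_cast Nat.choose_pos h0
  rw [div_lt_iff₀ hK] at h7
  rw [div_lt_iff₀ hm] at h8
  rw [div_lt_one hN] at h9
  have hkk : (k n : ℝ) ≤ (k n : ℝ) ^ 2 := by nlinarith
  refine ⟨?_, ?_, by exact_mod_cast h9, by exact_mod_cast (show (0 : ℝ) < k n by linarith)⟩
  · have : (2 : ℝ) * k n ≤ (n - 1 : ℕ) := by linarith
    exact_mod_cast this
  · have : (2 : ℝ) * k n ≤ m n := by linarith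
    exact_mod_cast this

/-! ### Degree thresholds -/

section Threshold
variable {T : ℕ → ℕ} {s : ℝ}

/-- Some integer threshold lies `√(2 log n) + s + o(1)` standard deviations above the average
degree. -/
theorem exists_threshold (hs : CriticalScaling γ k m) (s : ℝ) : ∃ T : ℕ → ℕ,
    Tendsto (fun n : ℕ => (T n - avgDeg m n) / √(avgDeg m n) - √(2 * Real.log n)) atTop (𝓝 s) := by
  refine ⟨fun n => ⌊avgDeg m n + √(avgDeg m n) * (√(2 * Real.log n) + s)⌋₊, ?_⟩
  have hb : Tendsto (fun n : ℕ => √(2 * Real.log n)) atTop atTop :=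
    Real.tendsto_sqrt_atTop.comp (tendsto_log_natCast.const_mul_atTop two_pos)
  have hσ : Tendsto (fun n : ℕ => √(avgDeg m n)) atTop atTop :=
    Real.tendsto_sqrt_atTop.comp hs.tendsto_avgDeg
  rw [tendsto_iff_norm_sub_tendsto_zero]
  refine squeeze_zero' (Eventually.of_forall fun n => norm_nonneg _) ?_ (hσ.const_div_atTop 1)
  filter_upwards [hs.eventually_pos, hb.eventually_ge_atTop (-s)]
    with n ⟨_, _, _, _, h5, _⟩ h7
  set d := avgDeg m n
  set b := √(2 * Real.log n)
  have hd : 0 < √d := Real.sqrt_pos.2 h5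
  have h8 : 0 ≤ d + √d * (b + s) := add_nonneg h5.le (mul_nonneg hd.le (by linarith))
  have h9 := Nat.floor_le h8
  have h10 := Nat.lt_floor_add_one (d + √d * (b + s))
  have e : ((⌊d + √d * (b + s)⌋₊ : ℝ) - d) / √d - b - s =
      ((⌊d + √d * (b + s)⌋₊ : ℝ) - (d + √d * (b + s))) / √d := by
    field_simp
    ring
  rw [Real.norm_eq_abs, e, abs_div, abs_of_pos hd]
  gcongr
  rw [abs_le]
  constructor <;> linarith

/-- Exponent of `starRatio / n` up to vanishing terms. With `a = k / √d`, `b = √(2 log n)` and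
`τ = (T - d) / √d` it is `a τ - a ^ 2 / 2 - b ^ 2 / 2`, which is `b (τ - b)` plus a convergent
sequence because `a - b` and `τ - b` converge. -/
theorem tendsto_add_mul_sub_sq (hs : CriticalScaling γ k m)
    (hT : Tendsto (fun n : ℕ => (T n - avgDeg m n) / √(avgDeg m n) - √(2 * Real.log n)) atTop
      (𝓝 s)) :
    ∃ c : ℝ, ∃ g : ℕ → ℝ, Tendsto g atTop (𝓝 c) ∧ ∀ᶠ n in atTop,
      k n * (T n - avgDeg m n) / avgDeg m n - (k n : ℝ) ^ 2 / (2 * avgDeg m n) - Real.log n =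
        √(2 * Real.log n) *
          ((T n - avgDeg m n) / √(avgDeg m n) - √(2 * Real.log n)) + g n := by
  refine ⟨_, _, (hs.tendsto_shift.mul hT).sub ((hs.tendsto_shift.pow 2).div_const 2), ?_⟩
  filter_upwards [hs.eventually_pos] with n ⟨_, h2, _, _, h5, _⟩
  set d := avgDeg m n
  have hd : 0 < √d := Real.sqrt_pos.2 h5
  have hdd : d = √d * √d := (Real.mul_self_sqrt h5.le).symm
  have hl : Real.log n = √(2 * Real.log n) * √(2 * Real.log n) / 2 := by
    rw [Real.mul_self_sqrt (by linarith)]; ring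
  set b := √(2 * Real.log n)
  set t : ℝ := (T n : ℝ) - d
  have e1 : k n * t / d = (k n / √d) * (t / √d) := by
    rw [div_mul_div_comm, ← hdd]
  have e2 : (k n : ℝ) ^ 2 / (2 * d) = (k n / √d) ^ 2 / 2 := by
    rw [div_pow, Real.sq_sqrt h5.le]; field_simp
  rw [hl, e1, e2]
  ring

/-- The relative deviations from the average degree are so small that the second-order terms in
the likelihood ratio vanish. This uses `(log n) ^ 2 = o(k)`. -/
theorem tendsto_second_order (hs : CriticalScaling γ k m)
    (hT : Tendsto (fun n : ℕ => (T n - avgDeg m n) / √(avgDeg m n) - √(2 * Real.log n)) atTop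
      (𝓝 s)) :
    Tendsto (fun n : ℕ => k n * ((|(T n : ℝ) - avgDeg m n| + k n) / avgDeg m n) ^ 2)
      atTop (𝓝 0) := by
  have h1 := (hT.div_atTop tendsto_sqrt_log).add_const √2
  have h2 := (hs.tendsto_shift.div_atTop tendsto_sqrt_log).add_const √2
  have h3 := hs.tendsto_log_mul_div.mul ((h1.abs.add h2).pow 2)
  rw [zero_mul] at h3
  refine h3.congr' ?_
  filter_upwards [hs.eventually_pos] with n ⟨_, h2, _, _, h5, _⟩
  set d := avgDeg m n
  have hd : 0 < √d := Real.sqrt_pos.2 h5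
  have hl0 : 0 < Real.log n := by linarith
  have hb : √(2 * Real.log n) = √2 * √(Real.log n) := Real.sqrt_mul (by norm_num) _
  have hsl : 0 < √(Real.log n) := Real.sqrt_pos.2 hl0
  have e1 : ((T n - d) / √d - √(2 * Real.log n)) / √(Real.log n) + √2 =
      (T n - d) / (√d * √(Real.log n)) := by
    rw [hb]; field_simp; ring
  have e2 : (k n / √d - √(2 * Real.log n)) / √(Real.log n) + √2 =
      k n / (√d * √(Real.log n)) := by
    rw [hb]; field_simp; ring
  rw [e1, e2, abs_div, abs_of_pos (mul_pos hd hsl), ← add_div, div_pow, mul_pow,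
    Real.sq_sqrt h5.le, Real.sq_sqrt hl0.le]
  field_simp

theorem tendsto_sqrt_two_log : Tendsto (fun n : ℕ => √(2 * Real.log n)) atTop atTop :=
  Real.tendsto_sqrt_atTop.comp (tendsto_log_natCast.const_mul_atTop two_pos)

theorem eventually_deviation_le_half (hs : CriticalScaling γ k m)
    (hT : Tendsto (fun n : ℕ => (T n - avgDeg m n) / √(avgDeg m n) - √(2 * Real.log n)) atTop
      (𝓝 s)) :
    ∀ᶠ n in atTop, (|(T n : ℝ) - avgDeg m n| + k n) / avgDeg m n ≤ 1 / 2 ∧ k n ≤ T n := by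
  filter_upwards [hs.eventually_pos, (hs.tendsto_second_order hT).eventually
    (gt_mem_nhds (show (0 : ℝ) < 1 / 4 by norm_num))] with n ⟨_, _, h3, _, h5, _⟩ h7
  set y := (|(T n : ℝ) - avgDeg m n| + k n) / avgDeg m n with hy
  have hy0 : 0 ≤ y := by positivity
  have h8 : y ≤ 1 / 2 := by
    by_contra h
    push Not at h
    nlinarith
  refine ⟨h8, ?_⟩
  rw [hy, div_le_iff₀ h5] at h8
  have := neg_abs_le ((T n : ℝ) - avgDeg m n)
  have : (k n : ℝ) ≤ T n := by linarith
  exact_mod_cast this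

/-- Below the critical threshold the likelihood ratio of one hub is negligible against `n`. -/
theorem tendsto_starRatio_div (hs : CriticalScaling γ k m) (hs0 : s < 0)
    (hT : Tendsto (fun n : ℕ => (T n - avgDeg m n) / √(avgDeg m n) - √(2 * Real.log n)) atTop
      (𝓝 s)) :
    Tendsto (fun n : ℕ => starRatio (n - 1) ((n - 1).choose 2) (m n) (k n) (T n) / n)
      atTop (𝓝 0) := by
  obtain ⟨c, g, hg, hgeq⟩ := hs.tendsto_add_mul_sub_sq hT
  have h1 : Tendsto (fun n : ℕ => √(2 * Real.log n) *
      ((T n - avgDeg m n) / √(avgDeg m n) - √(2 * Real.log n))) atTop atBot :=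
    tendsto_sqrt_two_log.atTop_mul_neg hs0 hT
  have h2 := ((hs.tendsto_div_avgDeg.div_const 2).add (hs.tendsto_sq_div_pred.const_mul 2)).add
    (hs.tendsto_sq_div_edges.const_mul 2)
  have h3 := Real.tendsto_exp_atBot.comp ((h1.atBot_add hg).atBot_add h2)
  refine squeeze_zero' (Eventually.of_forall fun n =>
    div_nonneg (starRatio_nonneg _) (Nat.cast_nonneg _)) ?_ h3
  filter_upwards [hgeq, hs.eventually_pos, hs.eventually_admissible,
    hs.eventually_deviation_le_half hT] with n e ⟨h0, _, _, _, h5, _⟩ ⟨a1, a2, a3, a4⟩ ⟨_, a5⟩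
  have hn : (0 : ℝ) < n := by exact_mod_cast (show 0 < n by omega)
  have hN := choose_two_eq (show 0 < n by omega)
  have h6 := starRatio_le_exp (B := (n - 1).choose 2) a1 a2 (hN ▸ a3.le) a5
    (by rw [← hN]; exact avgDeg_eq m h0) h5
  simp only [Function.comp]
  rw [← e, div_le_iff₀ hn]
  refine h6.trans (le_of_eq ?_)
  conv_rhs => rw [← Real.exp_log hn, ← Real.exp_add]
  congr 1
  rw [Real.log_exp]
  have := h5.ne'
  field_simp
  ring

/-- Above the critical threshold the likelihood ratio of one hub dominates `n`. -/
theorem tendsto_div_starRatio (hs : CriticalScaling γ k m) (hs0 : 0 < s)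
    (hT : Tendsto (fun n : ℕ => (T n - avgDeg m n) / √(avgDeg m n) - √(2 * Real.log n)) atTop
      (𝓝 s)) :
    Tendsto (fun n : ℕ => n / starRatio (n - 1) ((n - 1).choose 2) (m n) (k n) (T n)) atTop (𝓝 0) ∧
      ∀ᶠ n in atTop, 0 < starRatio (n - 1) ((n - 1).choose 2) (m n) (k n) (T n) := by
  obtain ⟨c, g, hg, hgeq⟩ := hs.tendsto_add_mul_sub_sq hT
  have h1 : Tendsto (fun n : ℕ => √(2 * Real.log n) *
      ((T n - avgDeg m n) / √(avgDeg m n) - √(2 * Real.log n))) atTop atTop :=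
    tendsto_sqrt_two_log.atTop_mul_pos hs0 hT
  have h2 := (hs.tendsto_second_order hT).const_mul (-2)
  have h3 := Real.tendsto_exp_neg_atTop_nhds_zero.comp ((h1.atTop_add hg).atTop_add h2)
  have hev : ∀ᶠ n : ℕ in atTop, (n : ℝ) * Real.exp (√(2 * Real.log n) *
      ((T n - avgDeg m n) / √(avgDeg m n) - √(2 * Real.log n)) + g n +
      -2 * (k n * ((|(T n : ℝ) - avgDeg m n| + k n) / avgDeg m n) ^ 2)) ≤
      starRatio (n - 1) ((n - 1).choose 2) (m n) (k n) (T n) := by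
    filter_upwards [hgeq, hs.eventually_pos, hs.eventually_admissible,
      hs.eventually_deviation_le_half hT] with n e ⟨h0, _, _, _, h5, _⟩ ⟨a1, a2, a3, a4⟩ ⟨a6, a5⟩
    have hn : (0 : ℝ) < n := by exact_mod_cast (show 0 < n by omega)
    have hN := choose_two_eq (show 0 < n by omega)
    have h6 := exp_le_starRatio (K := n - 1) (B := (n - 1).choose 2) (k := k n) (m := m n)
      (by omega) (by omega) (hN ▸ a3.le) a5 (by rw [← hN]; exact avgDeg_eq m h0) h5 a6
    refine le_trans (le_of_eq ?_) h6
    rw [← e]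
    conv_lhs => rw [← Real.exp_log hn, ← Real.exp_add]
    congr 1
    rw [Real.log_exp]
    ring
  constructor
  · refine squeeze_zero' (Eventually.of_forall fun n =>
      div_nonneg (Nat.cast_nonneg _) (starRatio_nonneg _)) ?_ h3
    filter_upwards [hev, eventually_ge_atTop 1] with n h4 h5
    have hn : (0 : ℝ) < n := by exact_mod_cast h5
    simp only [Function.comp]
    rw [Real.exp_neg]
    refine (div_le_div_of_nonneg_left hn.le (by positivity) h4).trans (le_of_eq ?_)
    rw [div_mul_eq_div_div, div_self hn.ne', one_div]
  · filter_upwards [hev, eventually_ge_atTop 1] with n h4 h5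
    have hn : (0 : ℝ) < n := by exact_mod_cast h5
    exact lt_of_lt_of_le (by positivity) h4

end Threshold
end CriticalScaling

/-! ### The limit of the hub degree and of the total variation distance -/

/-- Planting the star barely changes the mean of the remaining hub degree. -/
theorem avgDeg_sub_hubMean_bounds {m : ℕ → ℕ} {n k : ℕ} (hn : 2 ≤ n) (hK : 2 * k ≤ n - 1)
    (hm : 2 * k ≤ m n) (h : m n < n.choose 2) :
    0 ≤ avgDeg m n - (n - 1 - k : ℕ) * (m n - k : ℕ) / (n - 1 - k + (n - 1).choose 2 : ℕ) ∧
    avgDeg m n - (n - 1 - k : ℕ) * (m n - k : ℕ) / (n - 1 - k + (n - 1).choose 2 : ℕ) ≤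
      k * (2 / n + (m n : ℝ) / (n.choose 2 : ℕ)) := by
  have hN2 := choose_two_eq (show 0 < n by omega)
  have e1 : n - 1 - k + (n - 1).choose 2 = n.choose 2 - k := by omega
  rw [e1, avgDeg_eq m hn, Nat.cast_sub (show k ≤ n - 1 by omega),
    Nat.cast_sub (show k ≤ m n by omega), Nat.cast_sub (show k ≤ n.choose 2 by omega)]
  have hKn : (((n - 1 : ℕ) : ℝ)) / (n.choose 2 : ℕ) = 2 / n := by
    have h1 : ((n - 1 : ℕ) : ℝ) ≠ 0 := by exact_mod_cast (show n - 1 ≠ 0 by omega)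
    have h2 : (n : ℝ) ≠ 0 := by exact_mod_cast (show n ≠ 0 by omega)
    rw [cast_choose_two_eq hn]
    field_simp
  rw [← hKn]
  have hK' : (k : ℝ) ≤ (n - 1 : ℕ) := by exact_mod_cast (show k ≤ n - 1 by omega)
  have hm' : (k : ℝ) ≤ m n := by exact_mod_cast (show k ≤ m n by omega)
  have hmN : (m n : ℝ) < (n.choose 2 : ℕ) := by exact_mod_cast h
  have hk0 : (0 : ℝ) ≤ k := Nat.cast_nonneg k
  generalize ((n - 1 : ℕ) : ℝ) = K at *
  generalize ((n.choose 2 : ℕ) : ℝ) = N at *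
  generalize (m n : ℝ) = M at *
  generalize (k : ℝ) = κ at *
  have hN0 : 0 < N := by linarith
  have hNk : 0 < N - κ := by linarith
  have h1 : (M - κ) / (N - κ) ≤ M / N := by
    rw [div_le_div_iff₀ hNk hN0]; nlinarith
  have h2 : M / N - (M - κ) / (N - κ) ≤ κ / N := by
    have e : M / N - (M - κ) / (N - κ) = κ / N * ((N - M) / (N - κ)) := by
      field_simp
      ring
    rw [e]
    refine mul_le_of_le_one_right (by positivity) ?_
    rw [div_le_one hNk]; linarith
  have h3 : 0 ≤ (M - κ) / (N - κ) := div_nonneg (by linarith) hNk.le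
  have e : K * M / N - (K - κ) * (M - κ) / (N - κ) =
      K * (M / N - (M - κ) / (N - κ)) + κ * ((M - κ) / (N - κ)) := by ring
  rw [e]
  have hK0 : 0 ≤ K := by linarith
  constructor
  · exact add_nonneg (mul_nonneg hK0 (by linarith)) (mul_nonneg hk0 h3)
  · calc _ ≤ K * (κ / N) + κ * (M / N) := by gcongr
      _ = _ := by ring

namespace CriticalScaling
variable {γ : ℝ} {k m : ℕ → ℕ} {T : ℕ → ℕ} {s : ℝ}

/-- The bound of `avgDeg_sub_hubMean_bounds` is negligible against the standard deviation of the
degree. This uses `k = o(√n)`. -/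
theorem tendsto_mul_shift_error (hs : CriticalScaling γ k m) :
    Tendsto (fun n : ℕ => k n * (2 / n + (m n : ℝ) / (n.choose 2 : ℕ)) / √(avgDeg m n))
      atTop (𝓝 0) := by
  have h1 := (hs.tendsto_shift.div_atTop tendsto_sqrt_log).add_const √2
  have h2 := (tendsto_log_div.const_mul 2).add hs.tendsto_log_mul_density
  have h3 := h1.abs.mul h2
  simp only [mul_zero, add_zero] at h3
  refine squeeze_zero' ?_ ?_ h3
  · filter_upwards with n
    positivity
  · filter_upwards [hs.eventually_pos] with n ⟨h0, h2, h3, _, h5, _⟩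
    have hd : 0 < √(avgDeg m n) := Real.sqrt_pos.2 h5
    have hl0 : 0 < Real.log n := by linarith
    have hb : √(2 * Real.log n) = √2 * √(Real.log n) := Real.sqrt_mul (by norm_num) _
    have hsl : 0 < √(Real.log n) := Real.sqrt_pos.2 hl0
    have hsl1 : √(Real.log n) ≤ Real.log n := by
      have h1 : (1 : ℝ) ≤ √(Real.log n) := Real.one_le_sqrt.2 h2
      nlinarith [Real.mul_self_sqrt hl0.le]
    have e1 : (k n / √(avgDeg m n) - √(2 * Real.log n)) / √(Real.log n) + √2 =
        k n / (√(avgDeg m n) * √(Real.log n)) := by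
      rw [hb]; field_simp; ring
    have hn : (0 : ℝ) < n := by exact_mod_cast (show 0 < n by omega)
    rw [e1, abs_of_nonneg (by positivity)]
    calc k n * (2 / n + (m n : ℝ) / (n.choose 2 : ℕ)) / √(avgDeg m n)
        = k n / (√(avgDeg m n) * √(Real.log n)) *
          (√(Real.log n) * (2 / n + (m n : ℝ) / (n.choose 2 : ℕ))) := by field_simp
      _ ≤ k n / (√(avgDeg m n) * √(Real.log n)) *
          (Real.log n * (2 / n + (m n : ℝ) / (n.choose 2 : ℕ))) := by gcongr
      _ = _ := by ring

/-- The centred and scaled hub degree is asymptotically Gaussian, shifted by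
`√(2 log n) - γ / √2`. -/
theorem tendsto_hubCDF (hs : CriticalScaling γ k m)
    (hT : Tendsto (fun n : ℕ => (T n - avgDeg m n) / √(avgDeg m n) - √(2 * Real.log n)) atTop
      (𝓝 s)) :
    Tendsto (fun n : ℕ => hubCDF n (m n) (k n) (T n)) atTop (𝓝 (stdGaussianCDF (γ / √2 + s))) := by
  have hσ : Tendsto (fun n : ℕ => √(avgDeg m n)) atTop atTop :=
    Real.tendsto_sqrt_atTop.comp hs.tendsto_avgDeg
  have hmain := tendsto_hyperMean_le (K := fun n => n - 1 - k n) (B := fun n => (n - 1).choose 2)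
    (m := fun n => m n - k n) (σ := fun n => √(avgDeg m n)) (c := fun n => (T n : ℝ) - k n)
    (x := γ / √2 + s) ?_ hσ ?_ ?_
  · refine hmain.congr fun n => ?_
    rw [hubCDF]
    congr 1
    ext i
    have : (i : ℝ) ≤ T n - k n ↔ i + k n ≤ T n := by
      rw [le_sub_iff_add_le]; exact_mod_cast Iff.rfl
    simp only [this]
  · filter_upwards [hs.eventually_pos, hs.eventually_admissible] with n ⟨h0, _⟩ ⟨a1, a2, a3, a4⟩
    have := choose_two_eq (show 0 < n by omega)
    omega
  · have h1 := (tendsto_const_div_atTop_nhds_zero_nat (8 : ℝ)).add (hs.tendsto_density.const_mul 2)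
    have h2 := h1.add (hs.tendsto_mul_shift_error.div_atTop hσ)
    simp only [mul_zero, add_zero] at h2
    refine squeeze_zero' (Eventually.of_forall fun n => steinError_nonneg _ _ _ _) ?_ h2
    filter_upwards [hs.eventually_pos, hs.eventually_admissible]
      with n ⟨h0, _, _, _, h5, _⟩ ⟨a1, a2, a3, a4⟩
    obtain ⟨b1, b2⟩ := avgDeg_sub_hubMean_bounds h0 a1 a2 a3
    have hN2 := choose_two_eq (show 0 < n by omega)
    have e1 : n - 1 - k n + (n - 1).choose 2 = n.choose 2 - k n := by omega
    rw [steinError, Real.sq_sqrt h5.le]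
    set μ : ℝ := (n - 1 - k n : ℕ) * (m n - k n : ℕ) / (n - 1 - k n + (n - 1).choose 2 : ℕ) with hμ
    have hμ0 : 0 ≤ μ := by positivity
    have hN0 : (0 : ℝ) < (n.choose 2 : ℕ) := by exact_mod_cast Nat.choose_pos h0
    have hhalf : ((n.choose 2 : ℕ) : ℝ) / 2 ≤ (n - 1 - k n + (n - 1).choose 2 : ℕ) := by
      rw [e1, div_le_iff₀ two_pos]
      exact_mod_cast (show n.choose 2 ≤ (n.choose 2 - k n) * 2 by omega)
    have hKn : ((n - 1 : ℕ) : ℝ) / (n.choose 2 : ℕ) = 2 / n := by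
      have h1 : ((n - 1 : ℕ) : ℝ) ≠ 0 := by exact_mod_cast (show n - 1 ≠ 0 by omega)
      have h2 : (n : ℝ) ≠ 0 := by exact_mod_cast (show n ≠ 0 by omega)
      rw [cast_choose_two_eq h0]
      field_simp
    have hfac : (2 * ((n - 1 - k n : ℕ) : ℝ) + (m n - k n : ℕ)) /
        (n - 1 - k n + (n - 1).choose 2 : ℕ) ≤ 8 / n + 2 * ((m n : ℝ) / (n.choose 2 : ℕ)) := by
      have c1 : ((n - 1 - k n : ℕ) : ℝ) ≤ (n - 1 : ℕ) := by exact_mod_cast Nat.sub_le _ _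
      have c2 : ((m n - k n : ℕ) : ℝ) ≤ m n := by exact_mod_cast Nat.sub_le _ _
      calc _ ≤ (2 * ((n - 1 : ℕ) : ℝ) + m n) / ((n.choose 2 : ℕ) / 2) := by gcongr
        _ = 4 * (((n - 1 : ℕ) : ℝ) / (n.choose 2 : ℕ)) + 2 * ((m n : ℝ) / (n.choose 2 : ℕ)) := by
          field_simp; ring
        _ = _ := by rw [hKn]; ring
    have hfac0 : 0 ≤ (2 * ((n - 1 - k n : ℕ) : ℝ) + (m n - k n : ℕ)) /
        (n - 1 - k n + (n - 1).choose 2 : ℕ) := by positivity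
    rw [abs_sub_comm, abs_of_nonneg b1, add_div, div_div, Real.mul_self_sqrt h5.le]
    gcongr
    · refine le_trans ?_ hfac
      rw [div_le_iff₀ h5]
      exact mul_le_mul_of_nonneg_left (by linarith) hfac0
  · have herr : Tendsto (fun n : ℕ => (avgDeg m n - (n - 1 - k n : ℕ) * (m n - k n : ℕ) /
        (n - 1 - k n + (n - 1).choose 2 : ℕ)) / √(avgDeg m n)) atTop (𝓝 0) := by
      refine squeeze_zero' ?_ ?_ hs.tendsto_mul_shift_error
      all_goals
        filter_upwards [hs.eventually_pos, hs.eventually_admissible]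
          with n ⟨h0, _, _, _, h5, _⟩ ⟨a1, a2, a3, a4⟩
        obtain ⟨b1, b2⟩ := avgDeg_sub_hubMean_bounds h0 a1 a2 a3
      · positivity
      · gcongr
    have h1 := (hT.sub hs.tendsto_shift).add herr
    have e : s - -(γ / √2) + 0 = γ / √2 + s := by ring
    rw [e] at h1
    refine h1.congr fun n => ?_
    ring

theorem tendsto_variance_bound (hs : CriticalScaling γ k m) (hs0 : s < 0)
    (hT : Tendsto (fun n : ℕ => (T n - avgDeg m n) / √(avgDeg m n) - √(2 * Real.log n)) atTop
      (𝓝 s)) :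
    Tendsto (fun n : ℕ => √(starRatio (n - 1) ((n - 1).choose 2) (m n) (k n) (T n) / n +
        ((m n : ℝ) / n.choose 2) / (1 - (m n : ℝ) / n.choose 2) +
        ((k n : ℝ) / (n - 1 : ℕ) + (m n : ℝ) / n.choose 2) ^ 2 / ((m n : ℝ) / n.choose 2)))
      atTop (𝓝 0) := by
  have hq := hs.tendsto_density
  have h1 := hq.div (hq.const_sub 1) (by norm_num)
  have hk : Tendsto (fun n : ℕ => (k n : ℝ) / (n - 1 : ℕ)) atTop (𝓝 0) := by
    refine squeeze_zero' (Eventually.of_forall fun n => by positivity) ?_ hs.tendsto_sq_div_pred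
    filter_upwards [hs.eventually_pos] with n ⟨_, _, h3, _⟩
    gcongr
    nlinarith
  have h2 := ((hs.tendsto_sq_div_pred.div_atTop hs.tendsto_avgDeg).add (hk.const_mul 2)).add hq
  have h3 := (((hs.tendsto_starRatio_div hs0 hT).add h1).add h2).sqrt
  simp only [mul_zero, add_zero, zero_div, Real.sqrt_zero] at h3
  refine h3.congr' ?_
  filter_upwards [hs.eventually_pos] with n ⟨h0, _, _, _, h5, _⟩
  simp only [Pi.div_apply]
  congr 2
  rw [density_eq m h0]
  have h1 : ((n - 1 : ℕ) : ℝ) ≠ 0 := by exact_mod_cast (show n - 1 ≠ 0 by omega)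
  have h2 := h5.ne'
  field_simp
  ring

theorem tendsto_tvDist (hs : CriticalScaling γ k m) :
    Tendsto (fun n : ℕ => tvDist (plantedModel n (k n) (m n)) (nullModel n (m n)))
      atTop (𝓝 (1 - stdGaussianCDF (γ / √2))) := by
  have hcont : Tendsto (fun s => 1 - stdGaussianCDF (γ / √2 + s)) (𝓝 0)
      (𝓝 (1 - stdGaussianCDF (γ / √2))) := by
    have h1 : Continuous fun s => 1 - stdGaussianCDF (γ / √2 + s) :=
      continuous_const.sub (continuous_stdGaussianCDF.comp (by fun_prop))
    simpa using h1.tendsto 0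
  rw [tendsto_order]
  constructor
  · intro a ha
    obtain ⟨s, hsa, hs0⟩ := (((hcont.mono_left nhdsWithin_le_nhds).eventually
      (lt_mem_nhds ha)).and (self_mem_nhdsWithin (s := Set.Ioi (0 : ℝ)))).exists
    obtain ⟨T, hT⟩ := hs.exists_threshold s
    obtain ⟨h1, h2⟩ := hs.tendsto_div_starRatio hs0 hT
    have h3 := ((hs.tendsto_hubCDF hT).const_sub 1).sub h1
    rw [sub_zero] at h3
    filter_upwards [h3.eventually (lt_mem_nhds hsa), h2, hs.eventually_pos,
      hs.eventually_admissible] with n h4 h5 ⟨h0, _⟩ ⟨a1, a2, a3, a4⟩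
    exact h4.trans_le (one_sub_hubCDF_sub_le_tvDist (by omega) (by omega) (by omega) a3.le h5)
  · intro a ha
    obtain ⟨s, hsa, hs0⟩ := (((hcont.mono_left nhdsWithin_le_nhds).eventually
      (gt_mem_nhds ha)).and (self_mem_nhdsWithin (s := Set.Iio (0 : ℝ)))).exists
    obtain ⟨T, hT⟩ := hs.exists_threshold s
    have h3 := ((hs.tendsto_hubCDF hT).const_sub 1).add (hs.tendsto_variance_bound hs0 hT)
    rw [add_zero] at h3
    filter_upwards [h3.eventually (gt_mem_nhds hsa), hs.eventually_pos,
      hs.eventually_admissible] with n h4 ⟨h0, _⟩ ⟨a1, a2, a3, a4⟩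
    exact (tvDist_le_one_sub_hubCDF_add h0 (by omega) a4 (by omega) a3 (T n)).trans_lt h4

end CriticalScaling

end PlantedStar

/-- Since the edge count is an integer, `m n` is either of the two integers next to the
(generally non-integral) value of the scaling formula. -/
theorem theorem1 (γ : ℝ) (k m : ℕ → ℕ)
    (hk_lower : (fun n : ℕ => Real.log n ^ 2) =o[atTop] (fun n : ℕ => (k n : ℝ)))
    (hk_upper : (fun n : ℕ => (k n : ℝ)) =o[atTop] (fun n : ℕ => √(n : ℝ)))
    (hm : ∀ᶠ n : ℕ in atTop,
      |(m n : ℝ) - (k n : ℝ) ^ 2 * n / (4 * Real.log n) * (1 + γ / √(Real.log n))| < 1) :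
    Tendsto
      (fun n : ℕ =>
        PlantedStar.tvDist (PlantedStar.plantedModel n (k n) (m n))
          (PlantedStar.nullModel n (m n)))
      atTop (𝓝 (1 - PlantedStar.stdGaussianCDF (γ / √2))) := by
  exact PlantedStar.CriticalScaling.tendsto_tvDist ⟨hk_lower, hk_upper, hm⟩
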